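/- **Setting.** Let $R\subset\mathbb{R}^D$ be a bounded Borel set of positive Lebesgue measure, and let $\beta=(\beta_1,\dots,\beta_p)^T:R\to\mathbb{R}^p$ be a vector of basis functions (in the applications a spline basis): bounded, measurable and linearly independent, in the sense that $a^T\beta(u)=0$ for almost every $u\in R$ only if $a=0$. Let $q<r$ be integers, and let $b:\mathbb{R}\to\mathbb{R}^q$ satisfy $b(1)=0$ and have components that are linearly independent as functions on $\{1,\dots,r\}$ (for instance the monomials $b(t)=(t-1,(t-1)^2,\dots,(t-1)^q)^T$). For an integer $t\ge 1$ let $\{t\}_r\in\{1,\dots,r\}$ be its residue modulo $r$. Let $X_1,X_2,\dots$ be finite point processes on $R$ and $\Lambda_1,\Lambda_2,\dots$ random intensity functions on $R$ such that: * (A1) conditionally on the whole sequence $(\Lambda_t)_{t\ge1}$, the $X_t$ are independent and $X_t$ is a Poisson process with intensity function $\Lambda_t$; * (A2) $\log\Lambda_t(u)=\mu_0(u)+c_0(t)+Y_t(u)$, where $\{Y_t(u)\}_{t\ge 1,u\in R}$ is a (jointly) Gaussian family with mean zero, each $Y_t$ is jointly measurable in $u$ and the sample point, and the family is stationary in $t$,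 with autocovariance functions $\gamma_k(u,u')=\mathrm{cov}\{Y_t(u),Y_{t+k}(u')\}$, $k\in\mathbb{Z}$; * (A3) $\mu_0(u)=\theta_0^T\beta(u)$ and $c_0(t)=\tilde c_0(\{t\}_r)$ with $\tilde c_0(t)=\eta_0^T b(t)$, for some $\theta_0\in\mathbb{R}^p$, $\eta_0\in\mathbb{R}^q$; * (A4) $v_0(u)=\mathrm{var}\{Y_t(u)\}=\tau_0^T\beta(u)$ for some $\tau_0\in\mathbb{R}^p$; * (A5) $\lim_{k\to+\infty}\sup_{u,u'\in R}|\gamma_k(u,u')|=0$. Put $\lambda_0(u)=\exp\{\mu_0(u)+v_0(u)/2\}$. For $n\ge 1$ let $(\hat\theta,\hat\eta)=(\hat\theta_n,\hat\eta_n)$ be, whenever a maximizer exists, a maximizer over $\mathbb{R}^p\times\mathbb{R}^q$ (and arbitrary otherwise) of $$\rho_n(\theta,\eta)=-\frac1n\sum_{t=1}^n e^{\eta^Tb(\{t\}_r)}\int_R e^{\theta^T\beta(u)}\,du+\frac1n\sum_{t=1}^n \#X_t\;\eta^Tb(\{t\}_r)+\frac1n\sum_{t=1}^n\sum_{u\in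 X_t}\theta^T\beta(u),$$ and put $\hat{\tilde c}(t)=\hat\eta^Tb(t)$, $\hat\lambda(u)=\exp\{\hat\theta^T\beta(u)\}$. **Statement.** As $n\to\infty$, $\hat\eta\to\eta_0$ and $\hat\theta\to\theta_0+\tau_0/2$ in probability. Consequently $\hat{\tilde c}(t)\to\tilde c_0(t)$ in probability for every $t\in[1,r]$, and $\hat\lambda(u)\to\lambda_0(u)$ in probability for every $u\in R$. -/

import Mathlib

open MeasureTheory ProbabilityTheory Filter Topology

noncomputable section

/-- Lebesgue measure on the region `R`. -/
def regionVolume {D : ℕ} (R : Set (EuclideanSpace ℝ (Fin D))) : Measure R :=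
  Measure.comap Subtype.val volume

/-! ### Point patterns and Cox processes -/

/-- The number `N(B)` of points of the finite point pattern `x` that lie in `B`. -/
def pointCount {S : Type*} (B : Set S) (x : Finset S) : ℕ := ((x : Set S) ∩ B).ncard

/-- The σ-algebra on `Ω` generated by the random finite point pattern `X`, that is, by all its
counts `N(B)`, `B` measurable. -/
@[reducible] def pointSigma {Ω S : Type*} [MeasurableSpace S] (X : Ω → Finset S) : MeasurableSpace Ω :=
  ⨆ (B : Set S) (_ : MeasurableSet B), MeasurableSpace.comap (fun ω ↦ pointCount B (X ω)) ⊤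

/-- The σ-algebra generated by the latent processes `Λ t`, `t = 1, 2, …`. -/
@[reducible] def latentSigma {Ω S : Type*} (Λ : ℕ → S → Ω → ℝ) : MeasurableSpace Ω :=
  ⨆ (t : ℕ) (_ : 1 ≤ t) (u : S), MeasurableSpace.comap (Λ t u) (borel ℝ)

/-- Conditionally on `𝒢`, the finite point process `X` is a Poisson process whose intensity
function (with respect to the reference measure `ν`) is the random function `Λ`: given `𝒢`, the count `N(B)` is Poisson with rate `∫_B Λ`, and
the counts of disjoint sets are independent. -/
structure IsCondPoisson {Ω S : Type*} [MeasurableSpace Ω] [MeasurableSpace S] (μ : Measure Ω)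
    (ν : Measure S) (𝒢 : MeasurableSpace Ω) (X : Ω → Finset S) (Λ : S → Ω → ℝ) : Prop where
  count : ∀ B : Set S, MeasurableSet B → ∀ k : ℕ,
    μ⟦{ω | pointCount B (X ω) = k} | 𝒢⟧ =ᵐ[μ]
      fun ω ↦ (poissonMeasure (∫ u in B, Λ u ω ∂ν).toNNReal).real {k}
  indep : ∀ (m : ℕ) (B : Fin m → Set S), (∀ i, MeasurableSet (B i)) →
    Pairwise (fun i j ↦ Disjoint (B i) (B j)) → ∀ k : Fin m → ℕ,
    μ⟦{ω | ∀ i, pointCount (B i) (X ω) = k i} | 𝒢⟧ =ᵐ[μ]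
      fun ω ↦ ∏ i, (μ⟦{ω' | pointCount (B i) (X ω') = k i} | 𝒢⟧) ω

/-- `X 1, X 2, …` is a sequence of Cox processes driven by the latent intensities
`Λ 1, Λ 2, …`: given the latent processes, the `X t` are independent and `X t` is a Poisson process
with intensity function `Λ t`. -/
structure IsCoxSequence {Ω S : Type*} [MeasurableSpace Ω] [MeasurableSpace S] (μ : Measure Ω)
    (ν : Measure S) (X : ℕ → Ω → Finset S) (Λ : ℕ → S → Ω → ℝ) : Prop where
  measurable_count : ∀ t, 1 ≤ t → ∀ B : Set S, MeasurableSet B →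
    Measurable fun ω ↦ pointCount B (X t ω)
  condPoisson : ∀ t, 1 ≤ t → IsCondPoisson μ ν (latentSigma Λ) (X t) (Λ t)
  condIndep : ∀ T : Finset ℕ, (∀ t ∈ T, 1 ≤ t) → ∀ A : ℕ → Set Ω,
    (∀ t ∈ T, MeasurableSet[pointSigma (X t)] (A t)) →
    μ⟦⋂ t ∈ T, A t | latentSigma Λ⟧ =ᵐ[μ] fun ω ↦ ∏ t ∈ T, (μ⟦A t | latentSigma Λ⟧) ω

/-! ### The trend -/

/-- The residue `{t}_r` of `t` modulo `r`, taken in `{1, …, r}`. -/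
def periodResidue (r t : ℕ) : ℕ := if t % r = 0 then r else t % r

/-- `b` is a basis for trends of period `r`: it vanishes at `1`, and its components are linearly
independent as functions on the time points `1, …, r`. -/
structure IsTrendBasis {q : ℕ} (r : ℕ) (b : ℝ → EuclideanSpace ℝ (Fin q)) : Prop where
  at_one : b 1 = 0
  indep : ∀ a : EuclideanSpace ℝ (Fin q),
    (∀ t ∈ Finset.Icc 1 r, inner ℝ a (b (t : ℝ)) = 0) → a = 0

/-- The monomials `t - 1, (t - 1)², …, (t - 1)^q`. -/
def monomialTrend (q : ℕ) (t : ℝ) : EuclideanSpace ℝ (Fin q) :=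
  WithLp.toLp 2 fun l ↦ (t - 1) ^ ((l : ℕ) + 1)

/-- The centered monomials are a trend basis of period `r` as soon as `q < r`. -/
theorem isTrendBasis_monomialTrend {q r : ℕ} (h : q < r) : IsTrendBasis r (monomialTrend q) := by
  refine ⟨?_, fun a ha ↦ ?_⟩
  · ext l
    simp [monomialTrend]
  let P : Polynomial ℝ := ∑ l : Fin q, Polynomial.monomial ((l : ℕ) + 1) (a l)
  have hdeg : P.natDegree ≤ q := by
    refine Polynomial.natDegree_sum_le_of_forall_le _ _ fun l _ ↦ ?_
    exact (Polynomial.natDegree_monomial_le _).trans l.2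
  have hP : P = 0 := by
    refine Polynomial.eq_zero_of_natDegree_lt_card_of_eval_eq_zero P
      (f := fun i : Fin r ↦ ((i : ℕ) : ℝ)) (fun i j hij ↦ Fin.ext (Nat.cast_injective hij))
      (fun i ↦ ?_) (by simpa using hdeg.trans_lt h)
    have h1 := ha ((i : ℕ) + 1) (Finset.mem_Icc.2 ⟨by omega, i.2⟩)
    simp only [monomialTrend, PiLp.inner_apply, RCLike.inner_apply, conj_trivial, Nat.cast_add,
      Nat.cast_one, add_sub_cancel_right] at h1
    simp only [P, Polynomial.eval_finsetSum, Polynomial.eval_monomial]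
    rw [← h1]
    exact Finset.sum_congr rfl fun l _ ↦ mul_comm _ _
  ext l
  have h2 : P.coeff ((l : ℕ) + 1) = a l := by
    simp [P, Polynomial.coeff_monomial, Fin.val_inj]
  rw [← h2, hP]
  simp

/-! ### The working log-likelihood -/

/-- The function `ρ_n` of `(θ, η)` that the estimators maximize, for the point patterns
`x 1, …, x n`. -/
def workingLogLik {S : Type*} [MeasurableSpace S] (ν : Measure S) {p q : ℕ} (r : ℕ)
    (β : S → EuclideanSpace ℝ (Fin p)) (b : ℝ → EuclideanSpace ℝ (Fin q))
    (n : ℕ) (x : ℕ → Finset S)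
    (θ : EuclideanSpace ℝ (Fin p)) (η : EuclideanSpace ℝ (Fin q)) : ℝ :=
  -((1 / (n : ℝ)) * ∑ t ∈ Finset.Icc 1 n,
      Real.exp (inner ℝ η (b (periodResidue r t))) * ∫ u, Real.exp (inner ℝ θ (β u)) ∂ν)
    + (1 / (n : ℝ)) * ∑ t ∈ Finset.Icc 1 n,
      ((x t).card : ℝ) * inner ℝ η (b (periodResidue r t))
    + (1 / (n : ℝ)) * ∑ t ∈ Finset.Icc 1 n, ∑ u ∈ x t, inner ℝ θ (β u)

/-- `(θ, η)` is a maximizer of `ρ_n`. -/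
def IsWorkingMLE {S : Type*} [MeasurableSpace S] (ν : Measure S) {p q : ℕ} (r : ℕ)
    (β : S → EuclideanSpace ℝ (Fin p)) (b : ℝ → EuclideanSpace ℝ (Fin q))
    (n : ℕ) (x : ℕ → Finset S)
    (θ : EuclideanSpace ℝ (Fin p)) (η : EuclideanSpace ℝ (Fin q)) : Prop :=
  ∀ θ' η', workingLogLik ν r β b n x θ' η' ≤ workingLogLik ν r β b n x θ η

end

/-! The objective `ρ_n` sees the data only through three averages: the proportions of times with
each residue, the averages of the counts weighted by `b`, and the averages of the sums of `β` over
the points. For fixed averages it is concave in the parameter, and it is jointly continuous in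
averages and parameter. It therefore suffices that the averages converge in probability and that the
objective at the limit has a strict maximum at the claimed point.

Convergence is a weak law of large numbers. A log-normal mean is `exp` of mean plus half the
variance, so the intensity of `X t` has mean `exp (c₀ t) * exp (μ₀ + v₀ / 2)`. Mixed moments at lag
`k` carry the additional factor `exp (γ k)`. Conditioning on the latent processes transfers this to
the counts: their covariances at lag `k` are at most a constant times `exp (g k) - 1`, where `g`
dominates `γ`, plus a Poisson term at lag zero. These bounds vanish as the lag grows, so Chebyshev
and Cesàro give the law for counts, and uniform approximation by simple functions gives it for sums
over points (`HasIntensityMoments.tendsto_sumDeviation`).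

Since `v₀` lies in the span of `β`, the mean intensity belongs to the working model, with parameter
`θ₀ + τ₀ / 2`. With `s` the log-intensity of the model and `s₀` the true one, the limiting objective
averages `exp s₀ * s - exp s`, which is largest exactly at `s = s₀`; independence of the bases then
identifies the parameters (`profileLogLik_limitAverages_lt`). Concavity confines every maximizer to
a small ball once the objective is smaller on its boundary than at its centre
(`eventually_exists_maximizer_near`), so no uniform convergence over the whole parameter space is
needed. -/

/-! ### Convergence in probability as convergence along a filter -/

/-- The filter on `ℕ × Ω` of the sets whose `n`-th section has asymptotically null complement.
Convergence along this filter is convergence in probability. -/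
def inProb {Ω : Type*} [MeasurableSpace Ω] (μ : Measure Ω) : Filter (ℕ × Ω) where
  sets := {S | Tendsto (fun n ↦ μ {ω | (n, ω) ∉ S}) atTop (𝓝 0)}
  univ_sets := by simp
  sets_of_superset := by
    intro S T hS hST
    exact tendsto_of_tendsto_of_tendsto_of_le_of_le tendsto_const_nhds hS (fun _ ↦ zero_le)
      fun n ↦ measure_mono fun ω hω h ↦ hω (hST h)
  inter_sets := by
    intro S T hS hT
    have h := Tendsto.add hS hT
    rw [add_zero] at h
    refine tendsto_of_tendsto_of_tendsto_of_le_of_le tendsto_const_nhds h (fun _ ↦ zero_le)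
      fun n ↦ (measure_mono fun ω hω ↦ ?_).trans (measure_union_le _ _)
    by_contra hc
    simp only [Set.mem_union, Set.mem_ofPred_eq, not_or, not_not] at hc
    exact hω hc

section InProb

variable {Ω : Type*} [MeasurableSpace Ω] {μ : Measure Ω}

theorem eventually_inProb_iff {P : ℕ × Ω → Prop} :
    (∀ᶠ z in inProb μ, P z) ↔ Tendsto (fun n ↦ μ {ω | ¬ P (n, ω)}) atTop (𝓝 0) := Iff.rfl

/-- With convergence in probability expressed as a `Tendsto`, continuous mapping, sums, products of
spaces and `filter_upwards` come from the general theory of filters. -/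
theorem tendstoInMeasure_const_iff {E : Type*} [PseudoMetricSpace E] {f : ℕ → Ω → E} {c : E} :
    TendstoInMeasure μ f atTop (fun _ ↦ c) ↔
      Tendsto (fun z : ℕ × Ω ↦ f z.1 z.2) (inProb μ) (𝓝 c) := by
  rw [tendstoInMeasure_iff_dist, Metric.tendsto_nhds]
  simp_rw [eventually_inProb_iff, not_lt]

theorem eventually_inProb_of_ae {P : ℕ → Ω → Prop} (h : ∀ᶠ n in atTop, ∀ᵐ ω ∂μ, P n ω) :
    ∀ᶠ z in inProb μ, P z.1 z.2 := by
  rw [eventually_inProb_iff]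
  refine tendsto_const_nhds.congr' ?_
  filter_upwards [h] with n hn
  exact (ae_iff.1 hn).symm

theorem tendsto_fst_inProb : Tendsto Prod.fst (inProb μ) atTop := by
  intro s hs
  refine eventually_inProb_of_ae (P := fun n _ ↦ n ∈ s) ?_
  filter_upwards [hs] with n hn
  exact Eventually.of_forall fun _ ↦ hn

/-- Chebyshev: centered variables whose variance tends to zero tend to zero in probability. -/
theorem tendsto_inProb_of_variance [IsFiniteMeasure μ] {f : ℕ → Ω → ℝ}
    (hf : ∀ n, MemLp (f n) 2 μ) (hv : Tendsto (fun n ↦ Var[f n; μ]) atTop (𝓝 0)) :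
    Tendsto (fun z : ℕ × Ω ↦ f z.1 z.2 - μ[f z.1]) (inProb μ) (𝓝 0) := by
  rw [← tendstoInMeasure_const_iff (f := fun n ω ↦ f n ω - μ[f n]), tendstoInMeasure_iff_norm]
  intro ε hε
  have h : Tendsto (fun n ↦ ENNReal.ofReal (Var[f n; μ] / ε ^ 2)) atTop (𝓝 0) := by
    simpa using ENNReal.tendsto_ofReal (hv.div_const (ε ^ 2))
  refine tendsto_of_tendsto_of_tendsto_of_le_of_le tendsto_const_nhds h (fun _ ↦ zero_le)
    fun n ↦ ?_
  simpa using meas_ge_le_variance_div_sq (hf n) hε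

end InProb

/-! ### Averages -/

/-- Each lag occurs at most once on either side of `s`, and nonnegativity allows the missing lags to
be added. Since subtraction on `ℕ` truncates, `max - min` plays the role of the absolute difference.
-/
theorem sum_abs_sub_le {κ : ℕ → ℝ} (hκ : ∀ k, 0 ≤ κ k) {n s : ℕ} (hs : s ∈ Finset.Icc 1 n) :
    ∑ t ∈ Finset.Icc 1 n, κ (max s t - min s t) ≤ 2 * ∑ k ∈ Finset.range n, κ k := by
  rw [Finset.mem_Icc] at hs
  rw [← Finset.sum_filter_add_sum_filter_not _ (fun t ↦ s ≤ t), two_mul]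
  refine add_le_add ?_ ?_
  · rw [← Finset.sum_image (s := {t ∈ Finset.Icc 1 n | s ≤ t}) (f := κ)
      (g := fun t ↦ max s t - min s t)]
    · refine Finset.sum_le_sum_of_subset_of_nonneg (fun k hk ↦ ?_) fun k _ _ ↦ hκ k
      simp only [Finset.mem_image, Finset.mem_filter, Finset.mem_Icc, Finset.mem_range] at hk ⊢
      omega
    · intro x hx y hy hxy
      simp only [Finset.coe_filter, Finset.mem_Icc, Set.mem_ofPred_eq] at hx hy hxy
      omega
  · rw [← Finset.sum_image (s := {t ∈ Finset.Icc 1 n | ¬ s ≤ t}) (f := κ)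
      (g := fun t ↦ max s t - min s t)]
    · refine Finset.sum_le_sum_of_subset_of_nonneg (fun k hk ↦ ?_) fun k _ _ ↦ hκ k
      simp only [Finset.mem_image, Finset.mem_filter, Finset.mem_Icc, Finset.mem_range] at hk ⊢
      omega
    · intro x hx y hy hxy
      simp only [Finset.coe_filter, Finset.mem_Icc, Set.mem_ofPred_eq] at hx hy hxy
      omega

/-- Weak law of large numbers for square integrable variables whose covariances vanish as the
time lag grows. -/
theorem tendsto_inProb_average_of_covariance {Ω : Type*} [MeasurableSpace Ω] {μ : Measure Ω}
    [IsProbabilityMeasure μ] {M : ℕ → Ω → ℝ} (hM : ∀ t, 1 ≤ t → MemLp (M t) 2 μ) {κ : ℕ → ℝ}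
    (hκ0 : ∀ k, 0 ≤ κ k) (hκ : Tendsto κ atTop (𝓝 0))
    (hcov : ∀ s t, 1 ≤ s → s ≤ t → cov[M s, M t; μ] ≤ κ (t - s)) :
    Tendsto (fun z : ℕ × Ω ↦ (1 / (z.1 : ℝ)) * ∑ t ∈ Finset.Icc 1 z.1, (M t z.2 - μ[M t]))
      (inProb μ) (𝓝 0) := by
  have hM' : ∀ n, ∀ t ∈ Finset.Icc 1 n, MemLp (M t) 2 μ := fun n t ht ↦ hM t (Finset.mem_Icc.1 ht).1
  have hsum : ∀ n, MemLp (fun ω ↦ ∑ t ∈ Finset.Icc 1 n, M t ω) 2 μ := fun n ↦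
    memLp_finsetSum _ (hM' n)
  have h := tendsto_inProb_of_variance
    (f := fun n ω ↦ (1 / (n : ℝ)) * ∑ t ∈ Finset.Icc 1 n, M t ω)
    (fun n ↦ (hsum n).const_mul _) ?_
  · refine h.congr fun z ↦ ?_
    rw [integral_const_mul, integral_finsetSum _
      fun t ht ↦ (hM' _ t ht).integrable one_le_two, ← mul_sub, ← Finset.sum_sub_distrib]
  -- The variance is nonnegative, so upper bounds on the covariances are enough. The double sum is
  -- at most `n` times a bound on its rows, which leaves a Cesàro mean of `κ`.
  · have hb : ∀ n : ℕ, Var[fun ω ↦ (1 / (n : ℝ)) * ∑ t ∈ Finset.Icc 1 n, M t ω; μ] ≤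
        2 * ((n : ℝ)⁻¹ * ∑ k ∈ Finset.range n, κ k) := by
      intro n
      rcases Nat.eq_zero_or_pos n with rfl | hn
      · simp [show (fun _ : Ω ↦ (0 : ℝ)) = 0 from rfl]
      rw [variance_const_mul, variance_fun_sum' (hM' n)]
      have h1 : ∑ s ∈ Finset.Icc 1 n, ∑ t ∈ Finset.Icc 1 n, cov[M s, M t; μ] ≤
          ∑ s ∈ Finset.Icc 1 n, 2 * ∑ k ∈ Finset.range n, κ k := by
        refine Finset.sum_le_sum fun s hs ↦ le_trans (Finset.sum_le_sum fun t ht ↦ ?_)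
          (sum_abs_sub_le hκ0 hs)
        rw [Finset.mem_Icc] at hs ht
        rcases le_total s t with hst | hst
        · simpa [hst] using hcov s t hs.1 hst
        · rw [covariance_comm]
          simpa [hst] using hcov t s ht.1 hst
      rw [Finset.sum_const, Nat.card_Icc, nsmul_eq_mul, Nat.add_sub_cancel] at h1
      have hn' : (0 : ℝ) < n := by exact_mod_cast hn
      calc _ ≤ (1 / (n : ℝ)) ^ 2 * (n * (2 * ∑ k ∈ Finset.range n, κ k)) := by gcongr
        _ = _ := by field_simp
    have h2 := hκ.cesaro.const_mul 2
    rw [mul_zero] at h2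
    exact tendsto_of_tendsto_of_tendsto_of_le_of_le tendsto_const_nhds h2
      (fun n ↦ variance_nonneg _ _) hb

theorem periodResidue_add (r t : ℕ) : periodResidue r (t + r) = periodResidue r t := by
  simp [periodResidue]

theorem periodResidue_mem {r : ℕ} (hr : 0 < r) (t : ℕ) : periodResidue r t ∈ Finset.Icc 1 r := by
  have := Nat.mod_lt t hr
  unfold periodResidue
  split_ifs <;> rw [Finset.mem_Icc] <;> omega

theorem periodResidue_of_mem {r t : ℕ} (h : t ∈ Finset.Icc 1 r) : periodResidue r t = t := by
  rw [Finset.mem_Icc] at h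
  unfold periodResidue
  rcases h.2.eq_or_lt with h' | h'
  · simp [h']
  · rw [Nat.mod_eq_of_lt h', if_neg (by omega)]

/-- Averages of a periodic sequence tend to the average over a period. -/
theorem tendsto_average_periodResidue {r : ℕ} (hr : 0 < r) (h : ℕ → ℝ) :
    Tendsto (fun n : ℕ ↦ (1 / (n : ℝ)) * ∑ t ∈ Finset.Icc 1 n, h (periodResidue r t)) atTop
      (𝓝 ((1 / (r : ℝ)) * ∑ j ∈ Finset.Icc 1 r, h j)) := by
  set a := (1 / (r : ℝ)) * ∑ j ∈ Finset.Icc 1 r, h j with ha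
  have hr' : (0 : ℝ) < r := by exact_mod_cast hr
  -- The deviation of the partial sums from linear growth is periodic, hence bounded, and disappears
  -- after division by `n`.
  let d : ℕ → ℝ := fun n ↦ ∑ t ∈ Finset.Icc 1 n, h (periodResidue r t) - n * a
  have hd1 : ∀ n, d (n + 1) = d n + (h (periodResidue r (n + 1)) - a) := by
    intro n
    simp only [d]
    rw [Finset.sum_Icc_succ_top (by omega)]
    push_cast
    ring
  have hper : Function.Periodic d r := by
    intro n
    induction n with
    | zero =>
      simp only [d]
      rw [zero_add, Finset.sum_congr rfl fun t ht ↦ by rw [periodResidue_of_mem ht], ha]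
      simp
      field_simp
      ring
    | succ n ih =>
      rw [show n + 1 + r = n + r + 1 by ring, hd1, ih, hd1,
        show n + r + 1 = n + 1 + r by ring, periodResidue_add]
  have hbd : ∀ n, ‖d n‖ ≤ ∑ k ∈ Finset.range r, ‖d k‖ := by
    intro n
    rw [← hper.map_mod_nat n]
    exact Finset.single_le_sum (f := fun k ↦ ‖d k‖) (fun _ _ ↦ norm_nonneg _)
      (Finset.mem_range.2 (Nat.mod_lt n hr))
  have h0 : Tendsto (fun n : ℕ ↦ (1 / (n : ℝ)) * d n) atTop (𝓝 0) :=
    tendsto_one_div_atTop_nhds_zero_nat.zero_mul_isBoundedUnder_le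
      (isBoundedUnder_of ⟨_, hbd⟩)
  have h1 := h0.add_const a
  rw [zero_add] at h1
  refine h1.congr' ?_
  filter_upwards [eventually_gt_atTop 0] with n hn
  have : (0 : ℝ) < n := by exact_mod_cast hn
  simp only [d]
  field_simp
  ring

/-! ### Moments of Poisson counts with a random rate -/

/-- The Chen–Stein identity: `(k + 1) P(k + 1) = c P(k)`, and the term at zero vanishes. The choices
`g = 1` and `g k = k` give the first two moments. -/
theorem lintegral_poissonMeasure_mul (c : NNReal) (g : ℕ → ENNReal) :
    ∫⁻ k, k * g k ∂(poissonMeasure c) = c * ∫⁻ k, g (k + 1) ∂(poissonMeasure c) := by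
  rw [lintegral_countable', lintegral_countable', tsum_eq_zero_add' ENNReal.summable,
    ← ENNReal.tsum_mul_left]
  simp only [Nat.cast_zero, zero_mul, zero_add]
  refine tsum_congr fun k ↦ ?_
  have h : (((k + 1 : ℕ) : ENNReal)) * poissonMeasure c {k + 1} = c * poissonMeasure c {k} := by
    rw [poissonMeasure_singleton, poissonMeasure_singleton, ← ENNReal.ofReal_natCast,
      ← ENNReal.ofReal_coe_nnreal, ← ENNReal.ofReal_mul (by positivity),
      ← ENNReal.ofReal_mul (by positivity)]
    congr 1
    rw [Nat.factorial_succ]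
    push_cast
    field_simp
    ring
  rw [mul_right_comm, h]
  ring

theorem lintegral_poissonMeasure_id (c : NNReal) :
    ∫⁻ k, (k : ENNReal) ∂(poissonMeasure c) = c := by
  simpa using lintegral_poissonMeasure_mul c fun _ ↦ 1

theorem lintegral_poissonMeasure_sq (c : NNReal) :
    ∫⁻ k, (k : ENNReal) * k ∂(poissonMeasure c) = c * c + c := by
  rw [lintegral_poissonMeasure_mul]
  simp only [Nat.cast_add, Nat.cast_one]
  rw [lintegral_add_right _ measurable_const, lintegral_poissonMeasure_id]
  simp [mul_add]

section CondProb

variable {Ω : Type*} [m₀ : MeasurableSpace Ω] {μ : Measure Ω}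

/-- The tower property. Measurability of `f` is not assumed but inherited from the conditional
expectation it agrees with almost everywhere. -/
theorem measure_eq_lintegral_of_condExp [IsProbabilityMeasure μ] {A : Set Ω} (hA : MeasurableSet A)
    {𝒢 : MeasurableSpace Ω} (h𝒢 : 𝒢 ≤ m₀) {f : Ω → ℝ} (hf : 0 ≤ f) (h : μ⟦A | 𝒢⟧ =ᵐ[μ] f) :
    AEMeasurable f μ ∧ μ A = ∫⁻ ω, ENNReal.ofReal (f ω) ∂μ := by
  have hi : Integrable f μ := integrable_condExp.congr h
  refine ⟨hi.aemeasurable, ?_⟩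
  rw [← ofReal_integral_eq_lintegral_ofReal hi (Eventually.of_forall hf), ← integral_congr_ae h,
    integral_condExp h𝒢, integral_indicator (μ := μ) hA]
  simp

theorem lintegral_comp_eq_tsum {ι : Type*} [Countable ι] [MeasurableSpace ι]
    [MeasurableSingletonClass ι] {K : Ω → ι} (hK : Measurable K) (g : ι → ENNReal) :
    ∫⁻ ω, g (K ω) ∂μ = ∑' k, g k * μ {ω | K ω = k} := by
  rw [← lintegral_map (measurable_of_countable g) hK, lintegral_countable']
  refine tsum_congr fun k ↦ ?_
  rw [Measure.map_apply hK (measurableSet_singleton k)]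
  rfl

end CondProb

theorem latentSigma_le {Ω S : Type*} [m₀ : MeasurableSpace Ω] {Λ : ℕ → S → Ω → ℝ}
    (hΛ : ∀ t, 1 ≤ t → ∀ u, Measurable (Λ t u)) : latentSigma Λ ≤ m₀ := by
  refine iSup_le fun t ↦ iSup_le fun ht ↦ iSup_le fun u ↦ ?_
  rw [← BorelSpace.measurable_eq (α := ℝ)]
  exact (hΛ t ht u).comap_le

/-! ### Laws of the counts as mixtures of Poisson laws -/

section Cox

variable {Ω S : Type*} [m₀ : MeasurableSpace Ω] [MeasurableSpace S] {μ : Measure Ω}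
  [IsProbabilityMeasure μ] {ν : Measure S} {X : ℕ → Ω → Finset S} {Λ : ℕ → S → Ω → ℝ}

/-- The rate of the number of points of `X t` in `B`, given the latent processes. -/
noncomputable def condRate (ν : Measure S) (Λ : ℕ → S → Ω → ℝ) (t : ℕ) (B : Set S) (ω : Ω) : NNReal :=
  (∫ u in B, Λ t u ω ∂ν).toNNReal

namespace IsCoxSequence

theorem measure_count (hX : IsCoxSequence μ ν X Λ) (hΛ : ∀ t, 1 ≤ t → ∀ u, Measurable (Λ t u))
    {t : ℕ} (ht : 1 ≤ t) {B : Set S} (hB : MeasurableSet B) (k : ℕ) :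
    AEMeasurable (fun ω ↦ poissonMeasure (condRate ν Λ t B ω) {k}) μ ∧
      μ {ω | pointCount B (X t ω) = k} =
        ∫⁻ ω, poissonMeasure (condRate ν Λ t B ω) {k} ∂μ := by
  obtain ⟨h1, h2⟩ := measure_eq_lintegral_of_condExp
    (hX.measurable_count t ht B hB (measurableSet_singleton k)) (latentSigma_le hΛ) (fun ω ↦ measureReal_nonneg)
    ((hX.condPoisson t ht).count B hB k)
  have h3 : ∀ ω, ENNReal.ofReal ((poissonMeasure (condRate ν Λ t B ω)).real {k}) =
      poissonMeasure (condRate ν Λ t B ω) {k} := fun ω ↦ ofReal_measureReal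
  constructor
  · simp_rw [← h3]
    exact h1.ennreal_ofReal
  · simp_rw [← h3]
    exact h2

theorem measure_count_inter (hX : IsCoxSequence μ ν X Λ)
    (hΛ : ∀ t, 1 ≤ t → ∀ u, Measurable (Λ t u)) {s t : ℕ} (hs : 1 ≤ s) (ht : 1 ≤ t) (hst : s ≠ t)
    {B : Set S} (hB : MeasurableSet B) (k l : ℕ) :
    μ {ω | pointCount B (X s ω) = k ∧ pointCount B (X t ω) = l} =
      ∫⁻ ω, poissonMeasure (condRate ν Λ s B ω) {k} *
        poissonMeasure (condRate ν Λ t B ω) {l} ∂μ := by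
  -- Conditional independence takes a family of events indexed by all times; only the values at `s`
  -- and `t` matter.
  let A : ℕ → Set Ω := fun i ↦
    {ω | pointCount B (X i ω) = if i = s then k else l}
  have hA : ∀ i ∈ ({s, t} : Finset ℕ), MeasurableSet[pointSigma (X i)] (A i) := by
    intro i _
    refine MeasurableSpace.le_def.1 (le_iSup₂_of_le (ι := Set S) B hB le_rfl) _ ?_
    exact ⟨{if i = s then k else l}, trivial, rfl⟩
  have hst' : ∀ i ∈ ({s, t} : Finset ℕ), 1 ≤ i := by
    intro i hi
    rcases Finset.mem_insert.1 hi with rfl | hi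
    · exact hs
    · rw [Finset.mem_singleton.1 hi]
      exact ht
  have h := hX.condIndep {s, t} hst' A hA
  have hI : ⋂ i ∈ ({s, t} : Finset ℕ), A i =
      {ω | pointCount B (X s ω) = k ∧ pointCount B (X t ω) = l} := by
    ext ω
    simp [A, hst.symm]
  have hAs : A s = {ω | pointCount B (X s ω) = k} := by simp [A]
  have hAt : A t = {ω | pointCount B (X t ω) = l} := by simp [A, hst.symm]
  rw [hI] at h
  have hs' := (hX.condPoisson s hs).count B hB k
  have ht' := (hX.condPoisson t ht).count B hB l
  obtain ⟨-, h2⟩ := measure_eq_lintegral_of_condExp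
    (A := {ω | pointCount B (X s ω) = k ∧ pointCount B (X t ω) = l})
    ((hX.measurable_count s hs B hB (measurableSet_singleton k)).inter
      (hX.measurable_count t ht B hB (measurableSet_singleton l)))
    (latentSigma_le hΛ)
    (f := fun ω ↦ (poissonMeasure (condRate ν Λ s B ω)).real {k} *
      (poissonMeasure (condRate ν Λ t B ω)).real {l})
    (fun ω ↦ mul_nonneg measureReal_nonneg measureReal_nonneg) (by
      filter_upwards [h, hs', ht'] with ω h hs' ht'
      rw [h, Finset.prod_pair hst, hAs, hAt, hs', ht']
      rfl)
  rw [h2]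
  refine lintegral_congr fun ω ↦ ?_
  rw [ENNReal.ofReal_mul measureReal_nonneg, ofReal_measureReal, ofReal_measureReal]

theorem lintegral_count (hX : IsCoxSequence μ ν X Λ) (hΛ : ∀ t, 1 ≤ t → ∀ u, Measurable (Λ t u))
    {t : ℕ} (ht : 1 ≤ t) {B : Set S} (hB : MeasurableSet B) (g : ℕ → ENNReal) :
    ∫⁻ ω, g (pointCount B (X t ω)) ∂μ =
      ∫⁻ ω, ∫⁻ k, g k ∂(poissonMeasure (condRate ν Λ t B ω)) ∂μ := by
  rw [lintegral_comp_eq_tsum (hX.measurable_count t ht B hB)]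
  simp_rw [lintegral_countable' g]
  rw [lintegral_tsum fun k ↦ (hX.measure_count hΛ ht hB k).1.const_mul _]
  refine tsum_congr fun k ↦ ?_
  rw [(hX.measure_count hΛ ht hB k).2, lintegral_const_mul'' _ (hX.measure_count hΛ ht hB k).1]

/-- The joint law of the two counts is a mixture of products of Poisson laws, so the mixed moment
factors inside the mixture. -/
theorem lintegral_count_mul (hX : IsCoxSequence μ ν X Λ)
    (hΛ : ∀ t, 1 ≤ t → ∀ u, Measurable (Λ t u)) {s t : ℕ} (hs : 1 ≤ s) (ht : 1 ≤ t) (hst : s ≠ t)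
    {B : Set S} (hB : MeasurableSet B) :
    ∫⁻ ω, (pointCount B (X s ω) : ENNReal) * (pointCount B (X t ω) : ENNReal) ∂μ =
      ∫⁻ ω, (condRate ν Λ s B ω : ENNReal) * condRate ν Λ t B ω ∂μ := by
  rw [lintegral_comp_eq_tsum (g := fun k : ℕ × ℕ ↦ (k.1 : ENNReal) * k.2)
    ((hX.measurable_count s hs B hB).prodMk (hX.measurable_count t ht B hB))]
  simp only [Prod.ext_iff, hX.measure_count_inter hΛ hs ht hst hB]
  have hm : ∀ k : ℕ × ℕ, AEMeasurable (fun ω ↦ poissonMeasure (condRate ν Λ s B ω) {k.1} *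
        poissonMeasure (condRate ν Λ t B ω) {k.2}) μ := fun k ↦
    (hX.measure_count hΛ hs hB k.1).1.mul (hX.measure_count hΛ ht hB k.2).1
  simp_rw [← fun k : ℕ × ℕ ↦ lintegral_const_mul'' ((k.1 : ENNReal) * k.2) (hm k)]
  rw [← lintegral_tsum fun k ↦ (hm k).const_mul _]
  refine lintegral_congr fun ω ↦ ?_
  rw [ENNReal.tsum_prod']
  conv_rhs => rw [← lintegral_poissonMeasure_id (condRate ν Λ s B ω),
    ← lintegral_poissonMeasure_id (condRate ν Λ t B ω), lintegral_countable',
    lintegral_countable', ← ENNReal.tsum_mul_right]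
  refine tsum_congr fun k ↦ ?_
  rw [← ENNReal.tsum_mul_left]
  refine tsum_congr fun l ↦ ?_
  ring

end IsCoxSequence

end Cox

/-- Random intensities `Λ t` with means `lam t ≤ C`, whose mixed second moments at time lag `k`
exceed the product of the means at most by the factor `exp (g k)`. -/
structure HasIntensityMoments {Ω S : Type*} [MeasurableSpace Ω] [MeasurableSpace S] (μ : Measure Ω)
    (Λ : ℕ → S → Ω → ℝ) (lam : ℕ → S → ℝ) (g : ℕ → ℝ) (C : ℝ) : Prop where
  measurable : ∀ t, 1 ≤ t → Measurable fun z : S × Ω ↦ Λ t z.1 z.2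
  nonneg : ∀ t, 1 ≤ t → ∀ u ω, 0 ≤ Λ t u ω
  measurable_mean : ∀ t, 1 ≤ t → Measurable (lam t)
  mean_nonneg : ∀ t, 1 ≤ t → ∀ u, 0 ≤ lam t u
  mean_le : ∀ t, 1 ≤ t → ∀ u, lam t u ≤ C
  lintegral_eq : ∀ t, 1 ≤ t → ∀ u, ∫⁻ ω, ENNReal.ofReal (Λ t u ω) ∂μ = ENNReal.ofReal (lam t u)
  lintegral_mul_le : ∀ s t, 1 ≤ s → s ≤ t → ∀ u u',
    ∫⁻ ω, ENNReal.ofReal (Λ s u ω) * ENNReal.ofReal (Λ t u' ω) ∂μ ≤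
      ENNReal.ofReal (Real.exp (g (t - s))) * (ENNReal.ofReal (lam s u) * ENNReal.ofReal (lam t u'))

/-! ### Means and covariances of the counts -/

namespace HasIntensityMoments

variable {Ω S : Type*} [MeasurableSpace Ω] [MeasurableSpace S] {μ : Measure Ω}
  {ν : Measure S} {X : ℕ → Ω → Finset S} {Λ : ℕ → S → Ω → ℝ} {lam : ℕ → S → ℝ} {g : ℕ → ℝ} {C : ℝ}

theorem measurable_slice (h : HasIntensityMoments μ Λ lam g C) (t : ℕ) (ht : 1 ≤ t) (u : S) :
    Measurable (Λ t u) := (h.measurable t ht).comp measurable_prodMk_left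

theorem measurable_count_real (hX : IsCoxSequence μ ν X Λ) {t : ℕ} (ht : 1 ≤ t) {B : Set S}
    (hB : MeasurableSet B) : Measurable fun ω ↦ (pointCount B (X t ω) : ℝ) :=
  measurable_from_nat.comp (hX.measurable_count t ht B hB)

variable [IsFiniteMeasure ν]

theorem integrable_mean_mul (h : HasIntensityMoments μ Λ lam g C) {t : ℕ} (ht : 1 ≤ t)
    {f : S → ℝ} (hf : Measurable f) {K : ℝ} (hK : ∀ u, |f u| ≤ K) :
    Integrable (fun u ↦ f u * lam t u) ν := by
  refine Integrable.of_bound (C := K * C) (hf.mul (h.measurable_mean t ht)).aestronglyMeasurable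
    (Eventually.of_forall fun u ↦ ?_)
  rw [Real.norm_eq_abs, abs_mul, abs_of_nonneg (h.mean_nonneg t ht u)]
  exact mul_le_mul (hK u) (h.mean_le t ht u) (h.mean_nonneg t ht u) ((abs_nonneg _).trans (hK u))

theorem integrable_mean (h : HasIntensityMoments μ Λ lam g C) {t : ℕ} (ht : 1 ≤ t) :
    Integrable (lam t) ν := by
  simpa using h.integrable_mean_mul (ν := ν) ht (measurable_const (a := (1 : ℝ))) (K := 1) (by simp)

theorem measurable_rate (h : HasIntensityMoments μ Λ lam g C) {t : ℕ} (ht : 1 ≤ t) (B : Set S) :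
    Measurable fun ω ↦ ∫⁻ u in B, ENNReal.ofReal (Λ t u ω) ∂ν :=
  Measurable.lintegral_prod_left' (f := fun z : S × Ω ↦ ENNReal.ofReal (Λ t z.1 z.2))
    (h.measurable t ht).ennreal_ofReal

theorem mean_count_le (h : HasIntensityMoments μ Λ lam g C) {t : ℕ} (ht : 1 ≤ t) (B : Set S) :
    ∫ u in B, lam t u ∂ν ≤ C * ν.real Set.univ := by
  calc _ ≤ ∫ u, lam t u ∂ν :=
        setIntegral_le_integral (h.integrable_mean ht) (Eventually.of_forall (h.mean_nonneg t ht))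
    _ ≤ ∫ _, C ∂ν := integral_mono (h.integrable_mean ht) (integrable_const _) (h.mean_le t ht)
    _ = _ := by simp [mul_comm]

variable [IsProbabilityMeasure μ]

theorem lintegral_rate (h : HasIntensityMoments μ Λ lam g C) {t : ℕ} (ht : 1 ≤ t) (B : Set S) :
    ∫⁻ ω, ∫⁻ u in B, ENNReal.ofReal (Λ t u ω) ∂ν ∂μ = ENNReal.ofReal (∫ u in B, lam t u ∂ν) := by
  rw [lintegral_lintegral_swap]
  · simp_rw [h.lintegral_eq t ht]
    rw [ofReal_integral_eq_lintegral_ofReal (h.integrable_mean ht).integrableOn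
      (Eventually.of_forall (h.mean_nonneg t ht))]
  · exact ((h.measurable t ht).comp measurable_swap).ennreal_ofReal.aemeasurable

/-- The Bochner integral in `condRate` has the default value `0` when it diverges. The rate has
finite mean, so this occurs only on a null set, and Tonelli becomes available for the rates. -/
theorem condRate_ae_eq (h : HasIntensityMoments μ Λ lam g C) {t : ℕ} (ht : 1 ≤ t) (B : Set S) :
    (fun ω ↦ (condRate ν Λ t B ω : ENNReal)) =ᵐ[μ]
      fun ω ↦ ∫⁻ u in B, ENNReal.ofReal (Λ t u ω) ∂ν := by
  have hfin := ae_lt_top (h.measurable_rate (ν := ν) ht B)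
    (by rw [h.lintegral_rate ht]; exact ENNReal.ofReal_ne_top)
  filter_upwards [hfin] with ω hω
  have hm : Measurable fun u ↦ Λ t u ω := (h.measurable t ht).comp measurable_prodMk_right
  have hi : Integrable (fun u ↦ Λ t u ω) (ν.restrict B) := by
    refine ⟨hm.aestronglyMeasurable, ?_⟩
    rw [hasFiniteIntegral_iff_ofReal (Eventually.of_forall fun u ↦ h.nonneg t ht u ω)]
    exact hω
  rw [← ofReal_integral_eq_lintegral_ofReal hi (Eventually.of_forall fun u ↦ h.nonneg t ht u ω)]
  rfl

theorem lintegral_condRate (h : HasIntensityMoments μ Λ lam g C) {t : ℕ} (ht : 1 ≤ t)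
    (B : Set S) :
    ∫⁻ ω, (condRate ν Λ t B ω : ENNReal) ∂μ = ENNReal.ofReal (∫ u in B, lam t u ∂ν) := by
  rw [lintegral_congr_ae (h.condRate_ae_eq ht B), h.lintegral_rate ht]

/-- A product of rates is a double integral over `B × B`; after Tonelli the pointwise bound on mixed
moments applies under it. -/
theorem lintegral_condRate_mul_le (h : HasIntensityMoments μ Λ lam g C) {s t : ℕ} (hs : 1 ≤ s)
    (hst : s ≤ t) (B : Set S) :
    ∫⁻ ω, (condRate ν Λ s B ω : ENNReal) * condRate ν Λ t B ω ∂μ ≤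
      ENNReal.ofReal (Real.exp (g (t - s)) *
        ((∫ u in B, lam s u ∂ν) * ∫ u in B, lam t u ∂ν)) := by
  have ht := hs.trans hst
  have hmm : ∀ t, 1 ≤ t → Measurable fun z : S × Ω ↦ ENNReal.ofReal (Λ t z.1 z.2) :=
    fun t ht ↦ (h.measurable t ht).ennreal_ofReal
  have hmu : ∀ t, 1 ≤ t → ∀ ω, Measurable fun u ↦ ENNReal.ofReal (Λ t u ω) :=
    fun t ht ω ↦ (hmm t ht).comp measurable_prodMk_right
  have hl : ∀ t, 1 ≤ t → ∫⁻ u in B, ENNReal.ofReal (lam t u) ∂ν =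
      ENNReal.ofReal (∫ u in B, lam t u ∂ν) := fun t ht ↦
    (ofReal_integral_eq_lintegral_ofReal (h.integrable_mean ht).integrableOn
      (Eventually.of_forall (h.mean_nonneg t ht))).symm
  have hml : ∀ t, 1 ≤ t → Measurable fun u ↦ ENNReal.ofReal (lam t u) := fun t ht ↦
    (h.measurable_mean t ht).ennreal_ofReal
  calc _ = ∫⁻ ω, (∫⁻ u in B, ENNReal.ofReal (Λ s u ω) ∂ν) *
          (∫⁻ u in B, ENNReal.ofReal (Λ t u ω) ∂ν) ∂μ := by
        refine lintegral_congr_ae ?_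
        filter_upwards [h.condRate_ae_eq (ν := ν) hs B, h.condRate_ae_eq (ν := ν) ht B]
          with ω h1 h2
        rw [h1, h2]
    _ = ∫⁻ ω, (∫⁻ z, ENNReal.ofReal (Λ s z.1 ω) * ENNReal.ofReal (Λ t z.2 ω)
          ∂((ν.restrict B).prod (ν.restrict B))) ∂μ := by
        refine lintegral_congr fun ω ↦ ?_
        rw [lintegral_prod_mul (hmu s hs ω).aemeasurable (hmu t ht ω).aemeasurable]
    _ = ∫⁻ z, (∫⁻ ω, ENNReal.ofReal (Λ s z.1 ω) * ENNReal.ofReal (Λ t z.2 ω) ∂μ)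
          ∂((ν.restrict B).prod (ν.restrict B)) := by
        refine lintegral_lintegral_swap (Measurable.aemeasurable ?_)
        exact ((hmm s hs).comp (by fun_prop : Measurable fun z : Ω × S × S ↦ (z.2.1, z.1))).mul
          ((hmm t ht).comp (by fun_prop : Measurable fun z : Ω × S × S ↦ (z.2.2, z.1)))
    _ ≤ ∫⁻ z, ENNReal.ofReal (Real.exp (g (t - s))) *
          (ENNReal.ofReal (lam s z.1) * ENNReal.ofReal (lam t z.2))
          ∂((ν.restrict B).prod (ν.restrict B)) :=
        lintegral_mono fun z ↦ h.lintegral_mul_le s t hs hst z.1 z.2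
    _ = _ := by
        rw [lintegral_const_mul' _ _ ENNReal.ofReal_ne_top,
          lintegral_prod_mul (hml s hs).aemeasurable (hml t ht).aemeasurable, hl s hs, hl t ht,
          ENNReal.ofReal_mul (Real.exp_pos _).le,
          ENNReal.ofReal_mul (integral_nonneg (h.mean_nonneg s hs))]

theorem lintegral_count (h : HasIntensityMoments μ Λ lam g C) (hX : IsCoxSequence μ ν X Λ)
    {t : ℕ} (ht : 1 ≤ t) {B : Set S} (hB : MeasurableSet B) :
    ∫⁻ ω, (pointCount B (X t ω) : ENNReal) ∂μ = ENNReal.ofReal (∫ u in B, lam t u ∂ν) := by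
  rw [hX.lintegral_count h.measurable_slice ht hB fun k ↦ (k : ENNReal)]
  simp_rw [lintegral_poissonMeasure_id]
  rw [h.lintegral_condRate ht]

/-- At lag zero the Poisson second moment `c * c + c` contributes one extra mean rate; at positive
lags conditional independence leaves only the product of rates. -/
theorem lintegral_count_mul_le (h : HasIntensityMoments μ Λ lam g C)
    (hX : IsCoxSequence μ ν X Λ) {s t : ℕ} (hs : 1 ≤ s) (hst : s ≤ t) {B : Set S}
    (hB : MeasurableSet B) :
    ∫⁻ ω, (pointCount B (X s ω) : ENNReal) * (pointCount B (X t ω) : ENNReal) ∂μ ≤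
      ENNReal.ofReal (Real.exp (g (t - s)) *
        ((∫ u in B, lam s u ∂ν) * ∫ u in B, lam t u ∂ν) +
        if t - s = 0 then ∫ u in B, lam s u ∂ν else 0) := by
  have hnn : ∀ t, 1 ≤ t → 0 ≤ ∫ u in B, lam t u ∂ν := fun t ht ↦
    integral_nonneg (h.mean_nonneg t ht)
  rcases hst.eq_or_lt with rfl | hlt
  · rw [hX.lintegral_count h.measurable_slice hs hB fun k ↦ (k : ENNReal) * k]
    simp_rw [lintegral_poissonMeasure_sq]
    rw [lintegral_add_right' _ ((h.measurable_rate hs B).aemeasurable.congr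
      (h.condRate_ae_eq hs B).symm), h.lintegral_condRate hs, if_pos (Nat.sub_self _),
      ENNReal.ofReal_add (mul_nonneg (Real.exp_pos _).le (mul_nonneg (hnn s hs) (hnn s hs)))
        (hnn s hs)]
    gcongr
    exact h.lintegral_condRate_mul_le hs le_rfl B
  · rw [hX.lintegral_count_mul h.measurable_slice hs (hs.trans hst) hlt.ne hB,
      if_neg (by omega), add_zero]
    exact h.lintegral_condRate_mul_le hs hst B

theorem memLp_count (h : HasIntensityMoments μ Λ lam g C) (hX : IsCoxSequence μ ν X Λ)
    {t : ℕ} (ht : 1 ≤ t) {B : Set S} (hB : MeasurableSet B) :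
    MemLp (fun ω ↦ (pointCount B (X t ω) : ℝ)) 2 μ := by
  rw [memLp_two_iff_integrable_sq (measurable_count_real hX ht hB).aestronglyMeasurable]
  refine ⟨((measurable_count_real hX ht hB).pow_const 2).aestronglyMeasurable, ?_⟩
  rw [hasFiniteIntegral_iff_ofReal (Eventually.of_forall fun ω ↦ sq_nonneg _)]
  refine lt_of_le_of_lt (le_of_eq (lintegral_congr fun ω ↦ ?_))
    ((h.lintegral_count_mul_le hX ht le_rfl hB).trans_lt ENNReal.ofReal_lt_top)
  rw [sq, ENNReal.ofReal_mul (Nat.cast_nonneg _), ENNReal.ofReal_natCast]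

theorem integral_count (h : HasIntensityMoments μ Λ lam g C) (hX : IsCoxSequence μ ν X Λ)
    {t : ℕ} (ht : 1 ≤ t) {B : Set S} (hB : MeasurableSet B) :
    ∫ ω, (pointCount B (X t ω) : ℝ) ∂μ = ∫ u in B, lam t u ∂ν := by
  rw [integral_eq_lintegral_of_nonneg_ae (Eventually.of_forall fun ω ↦ Nat.cast_nonneg _)
    (measurable_count_real hX ht hB).aestronglyMeasurable]
  simp_rw [ENNReal.ofReal_natCast]
  rw [h.lintegral_count hX ht hB, ENNReal.toReal_ofReal (integral_nonneg (h.mean_nonneg t ht))]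

/-- Subtracting the product of means turns the factor `exp g` into `exp g - 1`. This is nonnegative
because `g` is, so the means may be replaced by their uniform bound. -/
theorem covariance_count_le (h : HasIntensityMoments μ Λ lam g C) (hX : IsCoxSequence μ ν X Λ)
    (hg : ∀ k, 0 ≤ g k) {s t : ℕ} (hs : 1 ≤ s) (hst : s ≤ t) {B : Set S} (hB : MeasurableSet B) :
    cov[fun ω ↦ (pointCount B (X s ω) : ℝ), fun ω ↦ (pointCount B (X t ω) : ℝ); μ] ≤
      (Real.exp (g (t - s)) - 1) * (C * ν.real Set.univ) ^ 2 +
        if t - s = 0 then C * ν.real Set.univ else 0 := by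
  have ht := hs.trans hst
  have hs0 : 0 ≤ ∫ u in B, lam s u ∂ν := integral_nonneg (h.mean_nonneg s hs)
  have ht0 : 0 ≤ ∫ u in B, lam t u ∂ν := integral_nonneg (h.mean_nonneg t ht)
  have hsC := h.mean_count_le (ν := ν) hs B
  have htC := h.mean_count_le (ν := ν) ht B
  rw [covariance_eq_sub (h.memLp_count hX hs hB) (h.memLp_count hX ht hB),
    h.integral_count hX hs hB, h.integral_count hX ht hB]
  have h1 : ∫ ω, (pointCount B (X s ω) : ℝ) * (pointCount B (X t ω) : ℝ) ∂μ ≤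
      Real.exp (g (t - s)) * ((∫ u in B, lam s u ∂ν) * ∫ u in B, lam t u ∂ν) +
        if t - s = 0 then ∫ u in B, lam s u ∂ν else 0 := by
    rw [integral_eq_lintegral_of_nonneg_ae
      (Eventually.of_forall fun ω ↦ mul_nonneg (Nat.cast_nonneg _) (Nat.cast_nonneg _))
      ((measurable_count_real hX hs hB).mul (measurable_count_real hX ht hB)).aestronglyMeasurable]
    refine ENNReal.toReal_le_of_le_ofReal ?_ ?_
    · split_ifs <;> positivity
    · simp_rw [ENNReal.ofReal_mul (Nat.cast_nonneg _), ENNReal.ofReal_natCast]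
      exact h.lintegral_count_mul_le hX hs hst hB
  have h2 : (if t - s = 0 then ∫ u in B, lam s u ∂ν else 0) ≤
      if t - s = 0 then C * ν.real Set.univ else 0 := by
    split_ifs <;> simp [hsC]
  have h3 : (∫ u in B, lam s u ∂ν) * (∫ u in B, lam t u ∂ν) ≤ (C * ν.real Set.univ) ^ 2 := by
    rw [sq]
    exact mul_le_mul hsC htC ht0 (hs0.trans hsC)
  have h4 : 0 ≤ Real.exp (g (t - s)) - 1 := by
    linarith [Real.add_one_le_exp (g (t - s)), hg (t - s)]
  calc _ ≤ (Real.exp (g (t - s)) - 1) * ((∫ u in B, lam s u ∂ν) * ∫ u in B, lam t u ∂ν) +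
        if t - s = 0 then ∫ u in B, lam s u ∂ν else 0 := by
          simp only [Pi.mul_apply]
          linarith
    _ ≤ _ := add_le_add (mul_le_mul_of_nonneg_left h3 h4) h2

end HasIntensityMoments

/-! ### The law of large numbers for sums over the points -/

theorem sum_indicator_one_eq_pointCount {S : Type*} (B : Set S) (x : Finset S) :
    ∑ u ∈ x, B.indicator (fun _ ↦ (1 : ℝ)) u = pointCount B x := by
  classical
  have : ((x : Set S) ∩ B) = ↑(x.filter (· ∈ B)) := by
    ext u
    simp
  rw [pointCount, this, Set.ncard_coe_finset, Finset.card_filter]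
  simp [Set.indicator_apply]

/-- The deviation of the weighted average of the sums of `f` over the points of `x 1, …, x n` from
its mean. -/
noncomputable def sumDeviation {S : Type*} [MeasurableSpace S] (ν : Measure S) (lam : ℕ → S → ℝ)
    (a : ℕ → ℝ) (n : ℕ) (x : ℕ → Finset S) (f : S → ℝ) : ℝ :=
  (1 / (n : ℝ)) * ∑ t ∈ Finset.Icc 1 n, a t * (∑ u ∈ x t, f u - ∫ u, f u * lam t u ∂ν)

/-- The values of a bounded function, rounded down to multiples of `ε`, as a finite sum of
indicators. -/
theorem exists_sum_indicator_near {S : Type*} [MeasurableSpace S] {f : S → ℝ} (hf : Measurable f)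
    {K : ℝ} (hK : ∀ u, |f u| ≤ K) {ε : ℝ} (hε : 0 < ε) :
    ∃ (s : Finset ℤ) (c : ℤ → ℝ) (B : ℤ → Set S), (∀ k, MeasurableSet (B k)) ∧
      ∀ u, |f u - ∑ k ∈ s, c k * (B k).indicator (fun _ ↦ (1 : ℝ)) u| ≤ ε := by
  classical
  refine ⟨Finset.Icc ⌊-K / ε⌋ ⌊K / ε⌋, fun k ↦ ε * k, fun k ↦ {u | ⌊f u / ε⌋ = k}, fun k ↦ ?_,
    fun u ↦ ?_⟩
  · exact (hf.div_const ε).floor (measurableSet_singleton k)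
  · have hmem : ⌊f u / ε⌋ ∈ Finset.Icc ⌊-K / ε⌋ ⌊K / ε⌋ := by
      rw [Finset.mem_Icc]
      have := abs_le.1 (hK u)
      exact ⟨Int.floor_le_floor (by gcongr; exact this.1),
        Int.floor_le_floor (by gcongr; exact this.2)⟩
    rw [Finset.sum_eq_single_of_mem _ hmem]
    · simp only [Set.indicator_apply, Set.mem_ofPred_eq, if_true, mul_one]
      have h1 := Int.floor_le (f u / ε)
      have h2 := Int.lt_floor_add_one (f u / ε)
      rw [le_div_iff₀ hε] at h1
      rw [div_lt_iff₀ hε] at h2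
      rw [abs_le]
      constructor <;> nlinarith
    · intro k _ hk
      simp [hk.symm]

namespace HasIntensityMoments

variable {Ω S : Type*} [MeasurableSpace Ω] [MeasurableSpace S] {μ : Measure Ω}
  {ν : Measure S} [IsFiniteMeasure ν] {X : ℕ → Ω → Finset S}
  {Λ : ℕ → S → Ω → ℝ} {lam : ℕ → S → ℝ} {g : ℕ → ℝ} {C : ℝ}

theorem sumDeviation_sum (h : HasIntensityMoments μ Λ lam g C) (a : ℕ → ℝ) (n : ℕ)
    (x : ℕ → Finset S) (s : Finset ℤ) (c : ℤ → ℝ) {B : ℤ → Set S} (hB : ∀ k, MeasurableSet (B k)) :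
    sumDeviation ν lam a n x (fun u ↦ ∑ k ∈ s, c k * (B k).indicator (fun _ ↦ (1 : ℝ)) u) =
      ∑ k ∈ s, c k * sumDeviation ν lam a n x ((B k).indicator fun _ ↦ 1) := by
  have hint : ∀ t, 1 ≤ t → ∀ k, Integrable
      (fun u ↦ (B k).indicator (fun _ ↦ (1 : ℝ)) u * lam t u) ν := fun t ht k ↦
    h.integrable_mean_mul ht (measurable_const.indicator (hB k)) (K := 1) fun u ↦ by
      by_cases hu : u ∈ B k <;> simp [hu]
  simp only [sumDeviation, Finset.mul_sum]
  rw [Finset.sum_comm]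
  refine Finset.sum_congr rfl fun t ht ↦ ?_
  simp_rw [Finset.sum_mul, mul_assoc]
  rw [integral_finsetSum _ fun k _ ↦ (hint t (Finset.mem_Icc.1 ht).1 k).const_mul (c k),
    Finset.sum_comm, ← Finset.sum_sub_distrib, Finset.mul_sum, Finset.mul_sum]
  refine Finset.sum_congr rfl fun k _ ↦ ?_
  rw [integral_const_mul, ← Finset.mul_sum]
  ring

/-- Each term changes by at most `ε * A` times the number of points plus its mean. Writing that
number as deviation plus mean bounds the error by the deviation of the total count, which is itself
covered by the law for indicators. -/
theorem abs_sumDeviation_sub_le (h : HasIntensityMoments μ Λ lam g C) {a : ℕ → ℝ} {A : ℝ}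
    (ha : ∀ t, |a t| ≤ A) (n : ℕ) (x : ℕ → Finset S) {f f' : S → ℝ} (hf : Measurable f)
    (hf' : Measurable f') {K K' : ℝ} (hK : ∀ u, |f u| ≤ K) (hK' : ∀ u, |f' u| ≤ K') {ε : ℝ}
    (hε : 0 ≤ ε) (hff' : ∀ u, |f u - f' u| ≤ ε) :
    |sumDeviation ν lam a n x f - sumDeviation ν lam a n x f'| ≤
      ε * A * (sumDeviation ν lam (fun _ ↦ 1) n x (Set.univ.indicator fun _ ↦ 1) +
        2 * (C * ν.real Set.univ)) := by
  have hA : 0 ≤ A := (abs_nonneg _).trans (ha 0)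
  have hterm : ∀ t ∈ Finset.Icc 1 n,
      |a t * (∑ u ∈ x t, f u - ∫ u, f u * lam t u ∂ν) -
        a t * (∑ u ∈ x t, f' u - ∫ u, f' u * lam t u ∂ν)| ≤
      ε * A * ((1 * (∑ u ∈ x t, (Set.univ.indicator (fun _ ↦ (1 : ℝ))) u -
        ∫ u, (Set.univ.indicator (fun _ ↦ (1 : ℝ))) u * lam t u ∂ν)) +
          2 * (C * ν.real Set.univ)) := by
    intro t ht
    have ht := (Finset.mem_Icc.1 ht).1
    have h1 : |∑ u ∈ x t, f u - ∑ u ∈ x t, f' u| ≤ ε * (x t).card := by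
      rw [← Finset.sum_sub_distrib]
      refine (Finset.abs_sum_le_sum_abs _ _).trans ((Finset.sum_le_sum fun u _ ↦ hff' u).trans ?_)
      simp [mul_comm]
    have h2 : |∫ u, f u * lam t u ∂ν - ∫ u, f' u * lam t u ∂ν| ≤ ε * ∫ u, lam t u ∂ν := by
      rw [← integral_sub (h.integrable_mean_mul ht hf hK) (h.integrable_mean_mul ht hf' hK'),
        ← integral_const_mul, ← Real.norm_eq_abs]
      refine norm_integral_le_of_norm_le ((h.integrable_mean ht).const_mul ε)
        (Eventually.of_forall fun u ↦ ?_)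
      rw [← sub_mul, Real.norm_eq_abs, abs_mul, abs_of_nonneg (h.mean_nonneg t ht u)]
      exact mul_le_mul_of_nonneg_right (hff' u) (h.mean_nonneg t ht u)
    have h3 : ∫ u, lam t u ∂ν ≤ C * ν.real Set.univ := by
      simpa using h.mean_count_le (ν := ν) ht Set.univ
    simp only [Set.indicator_univ, Finset.sum_const, nsmul_eq_mul, mul_one, one_mul]
    rw [← mul_sub, abs_mul]
    calc _ ≤ A * (ε * (x t).card + ε * ∫ u, lam t u ∂ν) := by
          refine mul_le_mul (ha t) ?_ (abs_nonneg _) hA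
          rw [show ∀ p q r s : ℝ, p - q - (r - s) = (p - r) - (q - s) by intros; ring]
          exact (abs_sub _ _).trans (add_le_add h1 h2)
      _ = ε * A * ((x t).card + ∫ u, lam t u ∂ν) := by ring
      _ ≤ _ := mul_le_mul_of_nonneg_left (by linarith) (mul_nonneg hε hA)
  simp only [sumDeviation]
  rw [← mul_sub, ← Finset.sum_sub_distrib, abs_mul, abs_of_nonneg (by positivity)]
  rcases Nat.eq_zero_or_pos n with rfl | hn
  · have := h.mean_count_le (ν := ν) le_rfl Set.univ
    have h0 : 0 ≤ C * ν.real Set.univ :=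
      (integral_nonneg (h.mean_nonneg 1 le_rfl)).trans this
    simp only [Nat.cast_zero, div_zero, zero_mul, zero_add]
    positivity
  have hn' : (0 : ℝ) < n := by exact_mod_cast hn
  calc _ ≤ (1 / (n : ℝ)) * ∑ t ∈ Finset.Icc 1 n, _ :=
        mul_le_mul_of_nonneg_left ((Finset.abs_sum_le_sum_abs _ _).trans
          (Finset.sum_le_sum hterm)) (by positivity)
    _ = _ := by
        rw [← Finset.mul_sum, Finset.sum_add_distrib, Finset.sum_const, Nat.card_Icc,
          nsmul_eq_mul, Nat.add_sub_cancel]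
        field_simp

variable [IsProbabilityMeasure μ]

/-- The covariances are bounded only from above, and multiplication by `a s * a t` preserves such a
bound when the weights are nonnegative. -/
theorem tendsto_sumDeviation_indicator_of_nonneg (h : HasIntensityMoments μ Λ lam g C)
    (hX : IsCoxSequence μ ν X Λ)
    (hg : ∀ k, 0 ≤ g k) (hg0 : Tendsto g atTop (𝓝 0)) {a : ℕ → ℝ} {A : ℝ}
    (ha0 : ∀ t, 0 ≤ a t) (ha : ∀ t, a t ≤ A) {B : Set S} (hB : MeasurableSet B) :
    Tendsto (fun z : ℕ × Ω ↦ sumDeviation ν lam a z.1 (fun t ↦ X t z.2)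
      (B.indicator fun _ ↦ 1)) (inProb μ) (𝓝 0) := by
  set V := C * ν.real Set.univ with hV
  let ψ : ℕ → ℝ := fun k ↦ (Real.exp (g k) - 1) * V ^ 2 + if k = 0 then V else 0
  have hV0 : 0 ≤ V := (integral_nonneg (h.mean_nonneg 1 le_rfl)).trans
    (h.mean_count_le (ν := ν) le_rfl B)
  have hψ0 : ∀ k, 0 ≤ ψ k := by
    intro k
    have : 0 ≤ Real.exp (g k) - 1 := by linarith [Real.add_one_le_exp (g k), hg k]
    simp only [ψ]
    split_ifs <;> positivity
  have hψ : Tendsto ψ atTop (𝓝 0) := by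
    have h1 : Tendsto (fun k ↦ (Real.exp (g k) - 1) * V ^ 2) atTop (𝓝 0) := by
      have := (((Real.continuous_exp.tendsto 0).comp hg0).sub_const 1).mul_const (V ^ 2)
      simpa using this
    refine h1.congr' ?_
    filter_upwards [eventually_gt_atTop 0] with k hk
    simp [ψ, hk.ne']
  have hmain := tendsto_inProb_average_of_covariance (μ := μ)
    (M := fun t ω ↦ a t * (pointCount B (X t ω) : ℝ)) (κ := fun k ↦ A ^ 2 * ψ k)
    (fun t ht ↦ (h.memLp_count hX ht hB).const_mul _)
    (fun k ↦ mul_nonneg (sq_nonneg _) (hψ0 k)) (by simpa using hψ.const_mul (A ^ 2)) ?_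
  · refine hmain.congr fun z ↦ ?_
    rw [sumDeviation]
    congr 1
    refine Finset.sum_congr rfl fun t ht ↦ ?_
    rw [integral_const_mul, h.integral_count hX (Finset.mem_Icc.1 ht).1 hB, ← mul_sub,
      sum_indicator_one_eq_pointCount, ← integral_indicator hB]
    congr 3
    ext u
    by_cases hu : u ∈ B <;> simp [hu]
  · intro s t hs hst
    rw [covariance_const_mul_left, covariance_const_mul_right, ← mul_assoc]
    calc _ ≤ a s * a t * ψ (t - s) := mul_le_mul_of_nonneg_left
          (h.covariance_count_le hX hg hs hst hB) (mul_nonneg (ha0 s) (ha0 t))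
      _ ≤ _ := by
        refine mul_le_mul_of_nonneg_right ?_ (hψ0 _)
        rw [sq]
        exact mul_le_mul (ha s) (ha t) (ha0 t) ((ha0 s).trans (ha s))

/-- Signed weights are the difference of the nonnegative weights `a + A` and `A`. -/
theorem tendsto_sumDeviation_indicator (h : HasIntensityMoments μ Λ lam g C)
    (hX : IsCoxSequence μ ν X Λ)
    (hg : ∀ k, 0 ≤ g k) (hg0 : Tendsto g atTop (𝓝 0)) {a : ℕ → ℝ} {A : ℝ}
    (ha : ∀ t, |a t| ≤ A) {B : Set S} (hB : MeasurableSet B) :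
    Tendsto (fun z : ℕ × Ω ↦ sumDeviation ν lam a z.1 (fun t ↦ X t z.2)
      (B.indicator fun _ ↦ 1)) (inProb μ) (𝓝 0) := by
  have h1 := h.tendsto_sumDeviation_indicator_of_nonneg hX hg hg0 (a := fun t ↦ a t + A)
    (A := A + A) (fun t ↦ by linarith [abs_le.1 (ha t)]) (fun t ↦ by linarith [abs_le.1 (ha t)]) hB
  have h2 := h.tendsto_sumDeviation_indicator_of_nonneg hX hg hg0 (a := fun _ ↦ A)
    (A := A) (fun t ↦ (abs_nonneg _).trans (ha t)) (fun t ↦ le_rfl) hB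
  have h3 := h1.sub h2
  rw [sub_zero] at h3
  refine h3.congr fun z ↦ ?_
  simp only [sumDeviation]
  rw [← mul_sub, ← Finset.sum_sub_distrib]
  congr 1
  exact Finset.sum_congr rfl fun t _ ↦ by ring

theorem tendsto_sumDeviation (h : HasIntensityMoments μ Λ lam g C)
    (hX : IsCoxSequence μ ν X Λ)
    (hg : ∀ k, 0 ≤ g k) (hg0 : Tendsto g atTop (𝓝 0)) {a : ℕ → ℝ} {A : ℝ}
    (ha : ∀ t, |a t| ≤ A) {f : S → ℝ} (hf : Measurable f) {K : ℝ} (hK : ∀ u, |f u| ≤ K) :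
    Tendsto (fun z : ℕ × Ω ↦ sumDeviation ν lam a z.1 (fun t ↦ X t z.2) f) (inProb μ) (𝓝 0) := by
  set V := C * ν.real Set.univ with hV
  have hV0 : 0 ≤ V := (integral_nonneg (h.mean_nonneg 1 le_rfl)).trans
    (h.mean_count_le (ν := ν) le_rfl Set.univ)
  have hA : 0 ≤ A := (abs_nonneg _).trans (ha 0)
  rw [Metric.tendsto_nhds]
  intro δ hδ
  -- Once the deviation of the total count is below `1`, the approximation error is at most `δ / 2`.
  -- The denominator uses `A + 1` because `A` may be zero.
  obtain ⟨ε, hε, hεδ⟩ : ∃ ε : ℝ, 0 < ε ∧ ε * A * (1 + 2 * V) ≤ δ / 2 := by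
    refine ⟨δ / 2 / ((A + 1) * (1 + 2 * V)), by positivity, ?_⟩
    rw [div_mul_eq_mul_div, div_mul_eq_mul_div, div_le_iff₀ (by positivity)]
    have : 0 ≤ δ / 2 * (1 + 2 * V) := by positivity
    nlinarith
  obtain ⟨s, c, B, hB, hfB⟩ := exists_sum_indicator_near hf hK hε
  set f' : S → ℝ := fun u ↦ ∑ k ∈ s, c k * (B k).indicator (fun _ ↦ (1 : ℝ)) u with hf'
  have hf'm : Measurable f' :=
    Finset.measurable_fun_sum _ fun k _ ↦ (measurable_const.indicator (hB k)).const_mul _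
  have hf'K : ∀ u, |f' u| ≤ K + ε := fun u ↦ by
    have h1 := abs_le.1 (hfB u)
    have h2 := abs_le.1 (hK u)
    rw [abs_le]
    constructor <;> linarith
  have h1 : Tendsto (fun z : ℕ × Ω ↦ sumDeviation ν lam a z.1 (fun t ↦ X t z.2) f')
      (inProb μ) (𝓝 0) := by
    simp only [hf', h.sumDeviation_sum _ _ _ _ _ hB]
    rw [← Finset.sum_const_zero (s := s)]
    refine tendsto_finsetSum _ fun k _ ↦ ?_
    simpa using (h.tendsto_sumDeviation_indicator hX hg hg0 ha (hB k)).const_mul (c k)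
  have h2 := h.tendsto_sumDeviation_indicator hX hg hg0 (a := fun _ ↦ 1) (A := 1) (by simp)
    MeasurableSet.univ
  filter_upwards [Metric.tendsto_nhds.1 h1 (δ / 2) (half_pos hδ),
    Metric.tendsto_nhds.1 h2 1 one_pos] with z hz1 hz2
  rw [Real.dist_0_eq_abs] at hz1 hz2 ⊢
  have h3 := h.abs_sumDeviation_sub_le (ν := ν) ha z.1 (fun t ↦ X t z.2) hf hf'm hK hf'K hε.le hfB
  have h4 : ε * A * (sumDeviation ν lam (fun _ ↦ 1) z.1 (fun t ↦ X t z.2)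
      (Set.univ.indicator fun _ ↦ 1) + 2 * V) ≤ ε * A * (1 + 2 * V) := by
    refine mul_le_mul_of_nonneg_left ?_ (mul_nonneg hε.le hA)
    linarith [le_abs_self (sumDeviation ν lam (fun _ ↦ 1) z.1 (fun t ↦ X t z.2)
      (Set.univ.indicator fun _ ↦ 1))]
  calc _ ≤ _ := abs_sub_abs_le_abs_sub _ _ |> sub_le_iff_le_add.1
    _ < δ := by linarith

end HasIntensityMoments

/-! ### Log-Gaussian intensities -/

theorem lintegral_exp_of_hasGaussianLaw {Ω : Type*} [MeasurableSpace Ω] {μ : Measure Ω}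
    {Z : Ω → ℝ} (hZ : HasGaussianLaw Z μ) (h0 : ∫ ω, Z ω ∂μ = 0) (c : ℝ) :
    ∫⁻ ω, ENNReal.ofReal (Real.exp (c + Z ω)) ∂μ =
      ENNReal.ofReal (Real.exp (c + Var[Z; μ] / 2)) := by
  have h1 := mgf_gaussianReal hZ.map_eq_gaussianReal 1
  -- A divergent moment generating function would have the default value `0`, so its being nonzero
  -- yields integrability.
  have hpos : mgf Z μ 1 ≠ 0 := by
    rw [h1]
    exact (Real.exp_pos _).ne'
  have hi : Integrable (fun ω ↦ Real.exp (Z ω)) μ := by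
    by_contra hc
    refine hpos (mgf_undef ?_)
    simpa using hc
  rw [h0, Real.coe_toNNReal _ (variance_nonneg _ _)] at h1
  simp only [mgf, one_mul, mul_one, one_pow, zero_add] at h1
  simp_rw [Real.exp_add, ENNReal.ofReal_mul (Real.exp_pos c).le]
  rw [lintegral_const_mul' _ _ ENNReal.ofReal_ne_top,
    ← ofReal_integral_eq_lintegral_ofReal hi (Eventually.of_forall fun _ ↦ (Real.exp_pos _).le), h1]

section LogGaussian

variable {Ω S : Type*} [MeasurableSpace Ω] {μ : Measure Ω}
  [IsProbabilityMeasure μ] {Y : ℕ → S → Ω → ℝ} {v₀ : S → ℝ} {γ : ℤ → S → S → ℝ}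

/-- Both `Y 1 u + Y (1 + k) u'` and `Y 1 u - Y (1 + k) u'` have nonnegative variance. The resulting
bound makes the supremum of the autocovariances finite at every lag. -/
theorem abs_autocovariance_le
    (hY : IsGaussianProcess (fun s : {t : ℕ // 1 ≤ t} × S ↦ Y s.1 s.2) μ)
    (hcov : ∀ s t, 1 ≤ s → 1 ≤ t → ∀ u u', cov[Y s u, Y t u'; μ] = γ ((t : ℤ) - (s : ℤ)) u u')
    (hv : ∀ t, 1 ≤ t → ∀ u, v₀ u = Var[Y t u; μ]) (k : ℕ) (u u' : S) :
    |γ k u u'| ≤ (v₀ u + v₀ u') / 2 := by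
  have hk : 1 ≤ 1 + k := by omega
  have h1 : MemLp (Y 1 u) 2 μ := (hY.hasGaussianLaw_eval (⟨1, le_rfl⟩, u)).memLp_two
  have h2 : MemLp (Y (1 + k) u') 2 μ := (hY.hasGaussianLaw_eval (⟨1 + k, hk⟩, u')).memLp_two
  have h3 := variance_add h1 h2
  have h4 := variance_sub h1 h2
  have h5 := hcov 1 (1 + k) le_rfl hk u u'
  rw [show ((1 + k : ℕ) : ℤ) - ((1 : ℕ) : ℤ) = k by push_cast; ring] at h5
  rw [h5, ← hv 1 le_rfl, ← hv _ hk] at h3 h4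
  have h6 := variance_nonneg (Y 1 u + Y (1 + k) u') μ
  have h7 := variance_nonneg (Y 1 u - Y (1 + k) u') μ
  rw [abs_le]
  constructor <;> linarith

/-- The sum `Y s u + Y t u'` is Gaussian with variance `v₀ u + v₀ u' + 2 γ`, so the mixed moment is
the product of the means times `exp γ`. -/
theorem hasIntensityMoments_logGaussian [MeasurableSpace S] {Λ : ℕ → S → Ω → ℝ} {μ₀ : S → ℝ} {c₀ : ℕ → ℝ}
    (hYm : ∀ t, 1 ≤ t → Measurable fun z : S × Ω ↦ Y t z.1 z.2)
    (hΛ : ∀ t, 1 ≤ t → ∀ u ω, Λ t u ω = Real.exp (μ₀ u + c₀ t + Y t u ω))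
    (hY : IsGaussianProcess (fun s : {t : ℕ // 1 ≤ t} × S ↦ Y s.1 s.2) μ)
    (hmean : ∀ t, 1 ≤ t → ∀ u, ∫ ω, Y t u ω ∂μ = 0)
    (hcov : ∀ s t, 1 ≤ s → 1 ≤ t → ∀ u u', cov[Y s u, Y t u'; μ] = γ ((t : ℤ) - (s : ℤ)) u u')
    (hv : ∀ t, 1 ≤ t → ∀ u, v₀ u = Var[Y t u; μ])
    (hμm : Measurable μ₀) (hvm : Measurable v₀) {Cμ Cc Cv : ℝ} (hμC : ∀ u, μ₀ u ≤ Cμ)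
    (hcC : ∀ t, 1 ≤ t → c₀ t ≤ Cc) (hvC : ∀ u, v₀ u ≤ Cv) {g : ℕ → ℝ}
    (hg : ∀ (k : ℕ) u u', γ k u u' ≤ g k) :
    HasIntensityMoments μ Λ (fun t u ↦ Real.exp (c₀ t) * Real.exp (μ₀ u + v₀ u / 2)) g
      (Real.exp Cc * Real.exp (Cμ + Cv / 2)) where
  measurable t ht := by
    simp_rw [hΛ t ht]
    exact (((hμm.comp measurable_fst).add_const _).add (hYm t ht)).exp
  nonneg t ht u ω := by
    rw [hΛ t ht]
    exact (Real.exp_pos _).le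
  measurable_mean t ht := (hμm.add (hvm.div_const 2)).exp.const_mul _
  mean_nonneg t ht u := by positivity
  mean_le t ht u := by
    have h1 := hμC u
    have h2 := hcC t ht
    have h3 := hvC u
    gcongr
  lintegral_eq t ht u := by
    simp_rw [hΛ t ht]
    rw [lintegral_exp_of_hasGaussianLaw (hY.hasGaussianLaw_eval (⟨t, ht⟩, u)) (hmean t ht u),
      ← hv t ht, ← Real.exp_add]
    congr 2
    ring
  lintegral_mul_le s t hs hst u u' := by
    have ht := hs.trans hst
    have h1 := hY.hasGaussianLaw_eval (⟨s, hs⟩, u)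
    have h2 := hY.hasGaussianLaw_eval (⟨t, ht⟩, u')
    have h3 := lintegral_exp_of_hasGaussianLaw
      (hY.hasGaussianLaw_add (s := (⟨s, hs⟩, u)) (t := (⟨t, ht⟩, u'))) (by
        simp only [Pi.add_apply]
        rw [integral_add h1.integrable h2.integrable, hmean s hs, hmean t ht, add_zero])
      (μ₀ u + c₀ s + (μ₀ u' + c₀ t))
    rw [variance_add h1.memLp_two h2.memLp_two] at h3
    simp only [Pi.add_apply] at h3
    rw [← hv s hs, ← hv t ht, hcov s t hs ht] at h3
    calc _ = _ := lintegral_congr fun ω ↦ by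
          rw [hΛ s hs, hΛ t ht, ← ENNReal.ofReal_mul (Real.exp_pos _).le, ← Real.exp_add,
            add_add_add_comm]
      _ = _ := h3
      _ ≤ _ := by
        rw [← ENNReal.ofReal_mul (by positivity), ← ENNReal.ofReal_mul (by positivity)]
        refine ENNReal.ofReal_le_ofReal ?_
        simp_rw [← Real.exp_add]
        refine Real.exp_le_exp.2 ?_
        have h4 := hg (t - s) u u'
        rw [Nat.cast_sub hst] at h4
        linarith

end LogGaussian

/-! ### Maximizers of nearby concave functions -/

/-- If `F z₀` has a strict maximum at `x₀`, then for all `z` near `z₀` for which `F z` is concave,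
`F z` has a maximizer, and all its maximizers are near `x₀`. -/
theorem eventually_exists_maximizer_near {Z E : Type*} [TopologicalSpace Z] [NormedAddCommGroup E]
    [NormedSpace ℝ E] [ProperSpace E] {F : Z → E → ℝ} (hF : Continuous fun y : Z × E ↦ F y.1 y.2)
    {z₀ : Z} {x₀ : E} (hmax : ∀ x, x ≠ x₀ → F z₀ x < F z₀ x₀) {ε : ℝ} (hε : 0 < ε) :
    ∀ᶠ z in 𝓝 z₀, ConcaveOn ℝ Set.univ (F z) →
      (∃ x, ∀ x', F z x' ≤ F z x) ∧ ∀ x, (∀ x', F z x' ≤ F z x) → dist x x₀ < ε := by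
  -- The strict inequality at `z₀` is open in `(z, x)` jointly, and compactness of the sphere makes
  -- the neighbourhood of `z₀` independent of `x`.
  have hsph : ∀ᶠ z in 𝓝 z₀, ∀ x ∈ Metric.sphere x₀ ε, F z x < F z x₀ := by
    refine (isCompact_sphere x₀ ε).eventually_forall_of_forall_eventually fun x hx ↦ ?_
    have hne : x ≠ x₀ := by
      rintro rfl
      rw [Metric.mem_sphere, dist_self] at hx
      exact hε.ne hx
    have h2 : Continuous fun y : Z × E ↦ F y.1 x₀ :=
      hF.comp (continuous_fst.prodMk continuous_const)
    exact hF.continuousAt.eventually_lt h2.continuousAt (hmax x hne)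
  filter_upwards [hsph] with z hz hconc
  -- The segment from `x₀` to an outer point meets the sphere; if the value at its far end were at
  -- least that at `x₀`, concavity would contradict `hz` there.
  have hout : ∀ x, ε ≤ dist x x₀ → F z x < F z x₀ := by
    intro x hx
    have hd : 0 < dist x x₀ := hε.trans_le hx
    set s := ε / dist x x₀ with hs
    have hs0 : 0 < s := by positivity
    have hs1 : s ≤ 1 := (div_le_one hd).2 hx
    have hy : (1 - s) • x₀ + s • x ∈ Metric.sphere x₀ ε := by
      rw [mem_sphere_iff_norm, show (1 - s) • x₀ + s • x - x₀ = s • (x - x₀) by module, norm_smul,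
        Real.norm_of_nonneg hs0.le, ← dist_eq_norm, hs, div_mul_cancel₀ _ hd.ne']
    have h1 := hz _ hy
    have h2 := hconc.2 (Set.mem_univ x₀) (Set.mem_univ x) (sub_nonneg.2 hs1) hs0.le (by ring)
    simp only [smul_eq_mul] at h2
    by_contra! hc
    nlinarith [mul_le_mul_of_nonneg_left hc hs0.le]
  have hzc : Continuous (F z) := hF.comp (continuous_const.prodMk continuous_id)
  obtain ⟨x, hx, hxmax⟩ := (isCompact_closedBall x₀ ε).exists_isMaxOn
    ⟨x₀, Metric.mem_closedBall_self hε.le⟩ hzc.continuousOn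
  refine ⟨⟨x, fun x' ↦ ?_⟩, fun x hx ↦ ?_⟩
  · rcases le_or_gt (dist x' x₀) ε with h | h
    · exact hxmax h
    · exact (hout x' h.le).le.trans (hxmax (Metric.mem_closedBall_self hε.le))
  · by_contra! hc
    exact absurd (hx x₀) (hout x hc).not_ge

/-! ### The working log-likelihood as a function of the data averages -/

section Likelihood

variable {S : Type*} [MeasurableSpace S] {p q : ℕ}

/-- The working log-likelihood as a function of the proportions `w j` of the times with residue
`j` and the averages of the counts weighted by `b` and of the sums of `β` over the points. -/
noncomputable def profileLogLik (ν : Measure S) (r : ℕ)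
    (β : S → EuclideanSpace ℝ (Fin p)) (b : ℝ → EuclideanSpace ℝ (Fin q))
    (z : (ℕ → ℝ) × (Fin q → ℝ) × (Fin p → ℝ))
    (x : EuclideanSpace ℝ (Fin p) × EuclideanSpace ℝ (Fin q)) : ℝ :=
  -(∑ j ∈ Finset.Icc 1 r, z.1 j * (Real.exp (inner ℝ x.2 (b j)) *
      ∫ u, Real.exp (inner ℝ x.1 (β u)) ∂ν))
    + ∑ l, z.2.1 l * x.2 l + ∑ l, z.2.2 l * x.1 l

/-- The data averages on which the working log-likelihood depends. -/
noncomputable def dataAverages (r : ℕ)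
    (β : S → EuclideanSpace ℝ (Fin p)) (b : ℝ → EuclideanSpace ℝ (Fin q)) (n : ℕ)
    (x : ℕ → Finset S) : (ℕ → ℝ) × (Fin q → ℝ) × (Fin p → ℝ) :=
  (fun j ↦ (1 / (n : ℝ)) * ∑ t ∈ Finset.Icc 1 n, if periodResidue r t = j then 1 else 0,
    fun l ↦ (1 / (n : ℝ)) * ∑ t ∈ Finset.Icc 1 n, b (periodResidue r t) l * ∑ _u ∈ x t, (1 : ℝ),
    fun l ↦ (1 / (n : ℝ)) * ∑ t ∈ Finset.Icc 1 n, (1 : ℝ) * ∑ u ∈ x t, β u l)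

/-- Grouping times by residue places the data in a space that does not depend on `n`, where
continuity at the limit makes sense. -/
theorem workingLogLik_eq_profileLogLik (ν : Measure S) {r : ℕ} (hr : 0 < r)
    (β : S → EuclideanSpace ℝ (Fin p)) (b : ℝ → EuclideanSpace ℝ (Fin q)) (n : ℕ)
    (x : ℕ → Finset S) (θ : EuclideanSpace ℝ (Fin p)) (η : EuclideanSpace ℝ (Fin q)) :
    workingLogLik ν r β b n x θ η = profileLogLik ν r β b (dataAverages r β b n x) (θ, η) := by
  simp only [workingLogLik, profileLogLik, dataAverages]
  congr 1
  · congr 1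
    · congr 1
      rw [← Finset.sum_fiberwise_of_maps_to (t := Finset.Icc 1 r)
        (fun t _ ↦ periodResidue_mem hr t), Finset.mul_sum]
      refine Finset.sum_congr rfl fun j _ ↦ ?_
      rw [mul_assoc, Finset.sum_mul, Finset.sum_filter]
      congr 1
      refine Finset.sum_congr rfl fun t _ ↦ ?_
      split_ifs with h
      · rw [h, one_mul]
      · rw [zero_mul]
    · simp_rw [mul_assoc, ← Finset.mul_sum, Finset.sum_mul]
      rw [Finset.sum_comm]
      congr 1
      refine Finset.sum_congr rfl fun t _ ↦ ?_
      rw [PiLp.inner_apply, Finset.mul_sum]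
      refine Finset.sum_congr rfl fun l _ ↦ ?_
      simp
      ring
  · simp_rw [one_mul, mul_assoc, ← Finset.mul_sum, Finset.sum_mul]
    rw [Finset.sum_comm]
    congr 1
    refine Finset.sum_congr rfl fun t _ ↦ ?_
    simp_rw [PiLp.inner_apply]
    rw [Finset.sum_comm]
    simp

variable {ν : Measure S} [IsFiniteMeasure ν] {β : S → EuclideanSpace ℝ (Fin p)}
  (hβm : Measurable β) {C : ℝ} (hβb : ∀ u, ‖β u‖ ≤ C)

include hβm hβb

theorem integrable_exp_inner (θ : EuclideanSpace ℝ (Fin p)) :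
    Integrable (fun u ↦ Real.exp (inner ℝ θ (β u))) ν := by
  refine Integrable.of_bound (C := Real.exp (‖θ‖ * C)) (by fun_prop)
    (Eventually.of_forall fun u ↦ ?_)
  rw [Real.norm_of_nonneg (Real.exp_pos _).le]
  refine Real.exp_le_exp.2 ((real_inner_le_norm _ _).trans ?_)
  exact mul_le_mul_of_nonneg_left (hβb u) (norm_nonneg _)

theorem continuous_integral_exp_inner :
    Continuous fun θ : EuclideanSpace ℝ (Fin p) ↦ ∫ u, Real.exp (inner ℝ θ (β u)) ∂ν := by
  refine continuous_iff_continuousAt.2 fun θ ↦ ?_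
  refine continuousAt_of_dominated (bound := fun _ ↦ Real.exp ((‖θ‖ + 1) * |C|))
    (Eventually.of_forall fun θ' ↦ by fun_prop) ?_ (integrable_const _)
    (Eventually.of_forall fun _ ↦ by fun_prop)
  have h : ∀ᶠ θ' in 𝓝 θ, ‖θ'‖ < ‖θ‖ + 1 :=
    continuous_norm.continuousAt.eventually_lt continuousAt_const (lt_add_one _)
  filter_upwards [h] with θ' hθ'
  refine Eventually.of_forall fun u ↦ ?_
  rw [Real.norm_of_nonneg (Real.exp_pos _).le]
  refine Real.exp_le_exp.2 ((real_inner_le_norm _ _).trans ?_)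
  exact mul_le_mul hθ'.le ((hβb u).trans (le_abs_self C)) (norm_nonneg _) (by positivity)

theorem continuous_profileLogLik (r : ℕ) (b : ℝ → EuclideanSpace ℝ (Fin q)) :
    Continuous fun y : ((ℕ → ℝ) × (Fin q → ℝ) × (Fin p → ℝ)) ×
      (EuclideanSpace ℝ (Fin p) × EuclideanSpace ℝ (Fin q)) ↦
        profileLogLik ν r β b y.1 y.2 := by
  have h := continuous_integral_exp_inner (ν := ν) hβm hβb
  unfold profileLogLik
  refine ((continuous_finsetSum _ fun j _ ↦ ?_).neg.add (continuous_finsetSum _ fun l _ ↦ ?_)).add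
    (continuous_finsetSum _ fun l _ ↦ ?_)
  · exact Continuous.mul (by fun_prop) (Continuous.mul (by fun_prop)
      (h.comp (continuous_fst.comp continuous_snd)))
  · fun_prop
  · fun_prop

/-- Products of convex functions need not be convex; here both factors merge under the integral into
the exponential of one linear form in `(θ, η)`. -/
theorem convexOn_exp_mul_integral_exp (a : EuclideanSpace ℝ (Fin q)) :
    ConvexOn ℝ Set.univ fun x : EuclideanSpace ℝ (Fin p) × EuclideanSpace ℝ (Fin q) ↦
      Real.exp (inner ℝ x.2 a) * ∫ u, Real.exp (inner ℝ x.1 (β u)) ∂ν := by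
  have hi := integrable_exp_inner (ν := ν) hβm hβb
  refine ⟨convex_univ, fun x _ y _ s t hs ht hst ↦ ?_⟩
  simp only [smul_eq_mul, ← integral_const_mul, Prod.fst_add, Prod.snd_add, Prod.smul_fst,
    Prod.smul_snd]
  rw [← integral_add (((hi _).const_mul _).const_mul _) (((hi _).const_mul _).const_mul _)]
  refine integral_mono ((hi _).const_mul _)
    ((((hi _).const_mul _).const_mul _).add (((hi _).const_mul _).const_mul _)) fun u ↦ ?_
  have h := convexOn_exp.2 (Set.mem_univ (inner ℝ x.2 a + inner ℝ x.1 (β u)))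
    (Set.mem_univ (inner ℝ y.2 a + inner ℝ y.1 (β u))) hs ht hst
  simp only [smul_eq_mul] at h
  simp only [← Real.exp_add, inner_add_left, inner_smul_left, conj_trivial]
  refine le_trans (le_of_eq ?_) h
  congr 1
  ring

theorem concaveOn_profileLogLik (r : ℕ) (b : ℝ → EuclideanSpace ℝ (Fin q))
    {z : (ℕ → ℝ) × (Fin q → ℝ) × (Fin p → ℝ)} (hz : ∀ j, 0 ≤ z.1 j) :
    ConcaveOn ℝ Set.univ (profileLogLik ν r β b z) := by
  refine ⟨convex_univ, fun x _ y _ s t hs ht hst ↦ ?_⟩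
  have h1 := Finset.sum_le_sum fun j (_ : j ∈ Finset.Icc 1 r) ↦ mul_le_mul_of_nonneg_left
    ((convexOn_exp_mul_integral_exp (ν := ν) hβm hβb (b j)).2 (Set.mem_univ x) (Set.mem_univ y)
      hs ht hst) (hz j)
  simp only [profileLogLik, smul_eq_mul, Prod.fst_add, Prod.snd_add, Prod.smul_fst, Prod.smul_snd,
    PiLp.add_apply, PiLp.smul_apply] at h1 ⊢
  simp only [mul_add, Finset.sum_add_distrib, mul_left_comm _ s, mul_left_comm _ t,
    ← Finset.mul_sum] at h1 ⊢
  linarith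

end Likelihood

/-! ### The limiting objective and its strict maximum -/

section Limit

variable {S : Type*} [MeasurableSpace S] {p q : ℕ}

/-- The limits of the data averages. -/
noncomputable def limitAverages (ν : Measure S) (r : ℕ)
    (β : S → EuclideanSpace ℝ (Fin p)) (b : ℝ → EuclideanSpace ℝ (Fin q))
    (θ : EuclideanSpace ℝ (Fin p)) (η : EuclideanSpace ℝ (Fin q)) :
    (ℕ → ℝ) × (Fin q → ℝ) × (Fin p → ℝ) :=
  (fun j ↦ (1 / (r : ℝ)) * ∑ i ∈ Finset.Icc 1 r, if i = j then 1 else 0,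
    fun l ↦ (1 / (r : ℝ)) * ∑ j ∈ Finset.Icc 1 r, b j l *
      (Real.exp (inner ℝ η (b j)) * ∫ u, 1 * Real.exp (inner ℝ θ (β u)) ∂ν),
    fun l ↦ (1 / (r : ℝ)) * ∑ j ∈ Finset.Icc 1 r, 1 *
      (Real.exp (inner ℝ η (b j)) * ∫ u, β u l * Real.exp (inner ℝ θ (β u)) ∂ν))

theorem abs_inner_le_of_bound {S E : Type*} [NormedAddCommGroup E] [InnerProductSpace ℝ E]
    {β : S → E} {C : ℝ} (hβb : ∀ u, ‖β u‖ ≤ C) (θ : E) (u : S) : |inner ℝ θ (β u)| ≤ ‖θ‖ * C :=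
  (abs_real_inner_le_norm _ _).trans (mul_le_mul_of_nonneg_left (hβb u) (norm_nonneg _))

/-- The tangent inequality for `exp` at `s₀`. The gap between the two sides is the Kullback–Leibler
divergence of Poisson laws with rates `exp s₀` and `exp s`. -/
theorem sub_exp_le (s s₀ : ℝ) :
    Real.exp s₀ * s - Real.exp s ≤ Real.exp s₀ * s₀ - Real.exp s₀ := by
  have h := mul_le_mul_of_nonneg_left (Real.add_one_le_exp (s - s₀)) (Real.exp_pos s₀).le
  rw [← Real.exp_add, add_sub_cancel] at h
  linarith

theorem sub_exp_lt {s s₀ : ℝ} (hs : s ≠ s₀) :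
    Real.exp s₀ * s - Real.exp s < Real.exp s₀ * s₀ - Real.exp s₀ := by
  have h := mul_lt_mul_of_pos_left (Real.add_one_lt_exp (sub_ne_zero.2 hs)) (Real.exp_pos s₀)
  rw [← Real.exp_add, add_sub_cancel] at h
  linarith

variable {ν : Measure S} [IsFiniteMeasure ν] {β : S → EuclideanSpace ℝ (Fin p)}
  (hβm : Measurable β) {C : ℝ} (hβb : ∀ u, ‖β u‖ ≤ C)

include hβm hβb

theorem integrable_mul_exp_inner {f : S → ℝ} (hf : Measurable f) {K : ℝ} (hK : ∀ u, |f u| ≤ K)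
    (θ : EuclideanSpace ℝ (Fin p)) :
    Integrable (fun u ↦ f u * Real.exp (inner ℝ θ (β u))) ν :=
  (integrable_exp_inner hβm hβb θ).bdd_mul hf.aestronglyMeasurable (Eventually.of_forall hK)

theorem integrable_profile_integrand (θ θ' : EuclideanSpace ℝ (Fin p)) (a a' : ℝ) :
    Integrable (fun u ↦ Real.exp (a + inner ℝ θ (β u)) * (a' + inner ℝ θ' (β u))
      - Real.exp (a' + inner ℝ θ' (β u))) ν := by
  have h1 := integrable_exp_inner (ν := ν) hβm hβb
  have h2 := integrable_mul_exp_inner (ν := ν) hβm hβb (f := fun u ↦ a' + inner ℝ θ' (β u))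
    (by fun_prop) (K := |a'| + ‖θ'‖ * C)
    (fun u ↦ (abs_add_le _ _).trans (by gcongr; exact abs_inner_le_of_bound hβb θ' u)) θ
  refine ((h2.const_mul (Real.exp a)).sub ((h1 θ').const_mul (Real.exp a'))).congr
    (Eventually.of_forall fun u ↦ ?_)
  simp only [Pi.sub_apply, Real.exp_add]
  ring

theorem profileLogLik_limitAverages (r : ℕ) (b : ℝ → EuclideanSpace ℝ (Fin q))
    (θ θ' : EuclideanSpace ℝ (Fin p)) (η η' : EuclideanSpace ℝ (Fin q)) :
    profileLogLik ν r β b (limitAverages ν r β b θ η) (θ', η') =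
      (1 / (r : ℝ)) * ∑ j ∈ Finset.Icc 1 r,
        ∫ u, (Real.exp (inner ℝ η (b j) + inner ℝ θ (β u)) *
          (inner ℝ η' (b j) + inner ℝ θ' (β u))
            - Real.exp (inner ℝ η' (b j) + inner ℝ θ' (β u))) ∂ν := by
  have h1 := integrable_exp_inner (ν := ν) hβm hβb
  have h2 := integrable_mul_exp_inner (ν := ν) hβm hβb (f := fun u ↦ inner ℝ θ' (β u))
    (by fun_prop) (abs_inner_le_of_bound hβb θ') θ
  have hint : ∀ j : ℕ, ∫ u, (Real.exp (inner ℝ η (b j) + inner ℝ θ (β u)) *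
          (inner ℝ η' (b j) + inner ℝ θ' (β u))
            - Real.exp (inner ℝ η' (b j) + inner ℝ θ' (β u))) ∂ν =
      inner ℝ η' (b j) * (Real.exp (inner ℝ η (b j)) * ∫ u, Real.exp (inner ℝ θ (β u)) ∂ν) +
      Real.exp (inner ℝ η (b j)) * ∫ u, inner ℝ θ' (β u) * Real.exp (inner ℝ θ (β u)) ∂ν -
      Real.exp (inner ℝ η' (b j)) * ∫ u, Real.exp (inner ℝ θ' (β u)) ∂ν := by
    intro j
    rw [← integral_const_mul, ← integral_const_mul, ← integral_const_mul, ← integral_const_mul,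
      ← integral_add (((h1 θ).const_mul _).const_mul _) (h2.const_mul _),
      ← integral_sub ((((h1 θ).const_mul _).const_mul _).fun_add (h2.const_mul _))
        ((h1 θ').const_mul _)]
    refine integral_congr_ae (Eventually.of_forall fun u ↦ ?_)
    simp only [Real.exp_add]
    ring
  have hB : ∑ l, (∫ u, β u l * Real.exp (inner ℝ θ (β u)) ∂ν) * θ' l =
      ∫ u, inner ℝ θ' (β u) * Real.exp (inner ℝ θ (β u)) ∂ν := by
    simp_rw [← integral_mul_const]
    rw [← integral_finsetSum]
    · refine integral_congr_ae (Eventually.of_forall fun u ↦ ?_)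
      simp only [PiLp.inner_apply, Finset.sum_mul]
      refine Finset.sum_congr rfl fun l _ ↦ ?_
      simp
      ring
    · intro l _
      refine (integrable_mul_exp_inner hβm hβb (by fun_prop) (K := C) (fun u ↦ ?_) θ).mul_const _
      exact (PiLp.norm_apply_le (β u) l).trans (hβb u)
  have hA : ∀ j : ℕ, inner ℝ η' (b j) = ∑ l, b j l * η' l := fun j ↦ by
    simp [PiLp.inner_apply]
  simp only [hint, profileLogLik, limitAverages, one_mul]
  rw [← hB]
  simp only [Finset.sum_add_distrib, Finset.sum_sub_distrib, mul_add, mul_sub]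
  rw [neg_add_eq_sub, sub_add_eq_add_sub]
  congr 1
  · congr 1
    · simp only [hA, Finset.sum_mul, mul_assoc, ← Finset.mul_sum]
      congr 1
      rw [Finset.sum_comm]
      refine Finset.sum_congr rfl fun j _ ↦ Finset.sum_congr rfl fun l _ ↦ ?_
      ring
    · simp only [Finset.sum_mul, mul_assoc, ← Finset.mul_sum]
      congr 1
      rw [Finset.sum_comm]
      refine Finset.sum_congr rfl fun j _ ↦ ?_
      rw [← Finset.mul_sum]
  · rw [Finset.mul_sum]
    refine Finset.sum_congr rfl fun j hj ↦ ?_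
    rw [Finset.sum_ite_eq' , if_pos hj, mul_one]

/-- The integrand is maximal pointwise at the true log-intensity, so equality of the integrals
forces equality of log-intensities almost everywhere for each residue, and the bases identify the
parameters. -/
theorem profileLogLik_limitAverages_lt {r : ℕ} (hr : 0 < r) (hν : ν ≠ 0)
    (hβi : ∀ a : EuclideanSpace ℝ (Fin p), (∀ᵐ u ∂ν, inner ℝ a (β u) = 0) → a = 0)
    {b : ℝ → EuclideanSpace ℝ (Fin q)} (hb : IsTrendBasis r b)
    (x₀ x : EuclideanSpace ℝ (Fin p) × EuclideanSpace ℝ (Fin q)) (hx : x ≠ x₀) :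
    profileLogLik ν r β b (limitAverages ν r β b x₀.1 x₀.2) x <
      profileLogLik ν r β b (limitAverages ν r β b x₀.1 x₀.2) x₀ := by
  obtain ⟨θ', η'⟩ := x
  obtain ⟨θ, η⟩ := x₀
  rw [profileLogLik_limitAverages hβm hβb, profileLogLik_limitAverages hβm hβb]
  have hr' : (0 : ℝ) < r := by exact_mod_cast hr
  refine mul_lt_mul_of_pos_left ?_ (by positivity)
  have hle : ∀ j ∈ Finset.Icc 1 r, _ := fun j _ ↦ integral_mono
    (integrable_profile_integrand (ν := ν) hβm hβb θ θ' (inner ℝ η (b j)) (inner ℝ η' (b j)))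
    (integrable_profile_integrand (ν := ν) hβm hβb θ θ (inner ℝ η (b j)) (inner ℝ η (b j)))
    fun u ↦ sub_exp_le _ _
  refine (Finset.sum_le_sum hle).lt_of_ne fun heq ↦ hx ?_
  have hj : ∀ j ∈ Finset.Icc 1 r, ∀ᵐ u ∂ν,
      inner ℝ η' (b j) + inner ℝ θ' (β u) = inner ℝ η (b j) + inner ℝ θ (β u) := by
    intro j hj
    have h1 := (Finset.sum_eq_sum_iff_of_le hle).1 heq j hj
    have h2 := (integral_eq_iff_of_ae_le
      (integrable_profile_integrand (ν := ν) hβm hβb θ θ' (inner ℝ η (b j)) (inner ℝ η' (b j)))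
      (integrable_profile_integrand (ν := ν) hβm hβb θ θ (inner ℝ η (b j)) (inner ℝ η (b j)))
      (Eventually.of_forall fun u ↦ sub_exp_le _ _)).1 h1
    filter_upwards [h2] with u hu
    by_contra hne
    exact (sub_exp_lt hne).ne hu
  -- At residue `1` the trend vanishes, which separates `θ` from `η`.
  have hθ : θ' = θ := by
    refine sub_eq_zero.1 (hβi _ ?_)
    filter_upwards [hj 1 (Finset.mem_Icc.2 ⟨le_rfl, hr⟩)] with u hu
    simp only [Nat.cast_one, hb.at_one, inner_zero_right, zero_add] at hu
    rw [inner_sub_left, hu, sub_self]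
  -- With `θ` known, a single point `u` for each residue suffices; one exists because `ν` is not
  -- zero.
  have hη : η' = η := by
    refine sub_eq_zero.1 (hb.indep _ fun j hjm ↦ ?_)
    have : NeBot (ae ν) := ae_neBot.2 hν
    obtain ⟨u, hu⟩ := (hj j hjm).exists
    rw [hθ] at hu
    rw [inner_sub_left, add_right_cancel hu, sub_self]
  rw [hθ, hη]

end Limit

/-! ### Convergence of the data averages -/

namespace HasIntensityMoments

variable {Ω S : Type*} [MeasurableSpace Ω] [MeasurableSpace S] {μ : Measure Ω}
  [IsProbabilityMeasure μ] {ν : Measure S} [IsFiniteMeasure ν] {X : ℕ → Ω → Finset S}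
  {Λ : ℕ → S → Ω → ℝ} {lam₀ : S → ℝ} {c : ℕ → ℝ} {g : ℕ → ℝ} {C : ℝ}

/-- Averages over time of sums over the points, with periodic weights, converge in probability. -/
theorem tendsto_average_sum
    (h : HasIntensityMoments μ Λ (fun t u ↦ Real.exp (c t) * lam₀ u) g C)
    (hX : IsCoxSequence μ ν X Λ) (hg : ∀ k, 0 ≤ g k) (hg0 : Tendsto g atTop (𝓝 0))
    {r : ℕ} (hr : 0 < r) {c' : ℕ → ℝ} (hc : ∀ t, 1 ≤ t → c t = c' (periodResidue r t)) (a : ℕ → ℝ)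
    {f : S → ℝ} (hf : Measurable f) {K : ℝ} (hK : ∀ u, |f u| ≤ K) :
    Tendsto (fun z : ℕ × Ω ↦ (1 / (z.1 : ℝ)) * ∑ t ∈ Finset.Icc 1 z.1,
        a (periodResidue r t) * ∑ u ∈ X t z.2, f u) (inProb μ)
      (𝓝 ((1 / (r : ℝ)) * ∑ j ∈ Finset.Icc 1 r,
        a j * (Real.exp (c' j) * ∫ u, f u * lam₀ u ∂ν))) := by
  have h1 := h.tendsto_sumDeviation (ν := ν) hX hg hg0 (a := fun t ↦ a (periodResidue r t))
    (A := ∑ j ∈ Finset.Icc 1 r, |a j|)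
    (fun t ↦ Finset.single_le_sum (f := fun j ↦ |a j|) (fun _ _ ↦ abs_nonneg _)
      (periodResidue_mem hr t)) hf hK
  have h2 := (tendsto_average_periodResidue hr
    fun j ↦ a j * (Real.exp (c' j) * ∫ u, f u * lam₀ u ∂ν)).comp (tendsto_fst_inProb (μ := μ))
  have h3 := h1.add h2
  rw [zero_add] at h3
  refine h3.congr fun z ↦ ?_
  simp only [sumDeviation, Function.comp_apply]
  rw [← mul_add, ← Finset.sum_add_distrib]
  congr 1
  refine Finset.sum_congr rfl fun t ht ↦ ?_
  rw [← hc t (Finset.mem_Icc.1 ht).1, ← integral_const_mul]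
  simp_rw [mul_left_comm (f _)]
  ring

end HasIntensityMoments

/-! ### Consistency -/

theorem regionVolume_univ {D : ℕ} {R : Set (EuclideanSpace ℝ (Fin D))} (hR : MeasurableSet R) :
    regionVolume R Set.univ = volume R := by
  rw [regionVolume, comap_subtype_coe_apply hR, Set.image_univ, Subtype.range_coe]

/-- The uniform bound `V` keeps the suprema finite, so `toReal` never takes its default value `0` at
infinity and really dominates `γ`. -/
theorem tendsto_toReal_iSup_enorm {S : Type*} {γ : ℤ → S → S → ℝ} {V : ℝ}
    (hV : ∀ (k : ℕ) u u', |γ k u u'| ≤ V)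
    (hγ : Tendsto (fun k : ℕ ↦ ⨆ (u : S) (u' : S), ‖γ (k : ℤ) u u'‖ₑ) atTop (𝓝 0)) :
    ∃ g : ℕ → ℝ, (∀ k, 0 ≤ g k) ∧ Tendsto g atTop (𝓝 0) ∧ ∀ (k : ℕ) u u', γ k u u' ≤ g k := by
  refine ⟨fun k ↦ (⨆ (u : S) (u' : S), ‖γ (k : ℤ) u u'‖ₑ).toReal, fun k ↦ ENNReal.toReal_nonneg,
    ?_, fun k u u' ↦ ?_⟩
  · simpa [Function.comp_def] using (ENNReal.tendsto_toReal ENNReal.zero_ne_top).comp hγ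
  · have hfin : (⨆ (u : S) (u' : S), ‖γ (k : ℤ) u u'‖ₑ) ≠ ⊤ := by
      refine ne_top_of_le_ne_top (ENNReal.ofReal_ne_top (r := V)) (iSup₂_le fun u u' ↦ ?_)
      rw [Real.enorm_eq_ofReal_abs]
      exact ENNReal.ofReal_le_ofReal (hV k u u')
    refine (le_abs_self _).trans ?_
    rw [← ENNReal.ofReal_le_iff_le_toReal hfin, ← Real.enorm_eq_ofReal_abs]
    exact le_iSup₂ (f := fun (u : S) (u' : S) ↦ ‖γ (k : ℤ) u u'‖ₑ) u u'

/-- Consistency of the maximizers of the working log-likelihood, once the data averages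
converge. -/
theorem tendsto_maximizer {Ω S : Type*} [MeasurableSpace Ω] [MeasurableSpace S] {μ : Measure Ω}
    {ν : Measure S} [IsFiniteMeasure ν] (hν : ν ≠ 0) {p q r : ℕ} (hr : 0 < r)
    {β : S → EuclideanSpace ℝ (Fin p)} (hβm : Measurable β) {C : ℝ} (hβb : ∀ u, ‖β u‖ ≤ C)
    (hβi : ∀ a : EuclideanSpace ℝ (Fin p), (∀ᵐ u ∂ν, inner ℝ a (β u) = 0) → a = 0)
    {b : ℝ → EuclideanSpace ℝ (Fin q)} (hb : IsTrendBasis r b) {X : ℕ → Ω → Finset S}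
    {θ : EuclideanSpace ℝ (Fin p)} {η : EuclideanSpace ℝ (Fin q)}
    (hlim : Tendsto (fun z : ℕ × Ω ↦ dataAverages r β b z.1 fun t ↦ X t z.2) (inProb μ)
      (𝓝 (limitAverages ν r β b θ η)))
    {θhat : ℕ → Ω → EuclideanSpace ℝ (Fin p)} {ηhat : ℕ → Ω → EuclideanSpace ℝ (Fin q)}
    (hest : ∀ n, 1 ≤ n → ∀ᵐ ω ∂μ,
      (∃ θ η, IsWorkingMLE ν r β b n (fun t ↦ X t ω) θ η) →
        IsWorkingMLE ν r β b n (fun t ↦ X t ω) (θhat n ω) (ηhat n ω)) :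
    Tendsto (fun z : ℕ × Ω ↦ (θhat z.1 z.2, ηhat z.1 z.2)) (inProb μ) (𝓝 (θ, η)) := by
  rw [Metric.tendsto_nhds]
  intro ε hε
  have h1 := hlim.eventually (eventually_exists_maximizer_near
    (continuous_profileLogLik (ν := ν) hβm hβb r b)
    (fun x hx ↦ profileLogLik_limitAverages_lt hβm hβb hr hν hβi hb (θ, η) x hx) hε)
  have h2 := eventually_inProb_of_ae (μ := μ) ((eventually_ge_atTop 1).mono hest)
  filter_upwards [h1, h2] with z hz1 hz2
  obtain ⟨⟨x, hx⟩, hnear⟩ := hz1 (concaveOn_profileLogLik hβm hβb r b fun j ↦ by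
    simp only [dataAverages]
    refine mul_nonneg (by positivity) (Finset.sum_nonneg fun t _ ↦ ?_)
    split_ifs <;> norm_num)
  simp only [IsWorkingMLE, workingLogLik_eq_profileLogLik _ hr] at hz2
  exact hnear _ fun x' ↦ hz2 ⟨x.1, x.2, fun θ' η' ↦ hx (θ', η')⟩ x'.1 x'.2

theorem corollary1
    -- the bounded region on which the point processes are observed, and the spline basis on it
    {D p q r : ℕ} (R : Set (EuclideanSpace ℝ (Fin D))) (hR : MeasurableSet R)
    (hRb : Bornology.IsBounded R) (hR0 : volume R ≠ 0)
    (β : R → EuclideanSpace ℝ (Fin p)) (hβm : Measurable β) (hβb : ∃ C : ℝ, ∀ u, ‖β u‖ ≤ C)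
    (hβi : ∀ a : EuclideanSpace ℝ (Fin p),
      (∀ᵐ u ∂(regionVolume R), inner ℝ a (β u) = 0) → a = 0)
    -- the basis for the trend
    (hqr : q < r) (b : ℝ → EuclideanSpace ℝ (Fin q)) (hb : IsTrendBasis r b)
    -- the probability space, the Gaussian processes, the latent intensities and the data
    {Ω : Type*} [MeasurableSpace Ω] (μ : Measure Ω) [IsProbabilityMeasure μ]
    (Y : ℕ → R → Ω → ℝ) (hYm : ∀ t, 1 ≤ t → Measurable fun z : R × Ω ↦ Y t z.1 z.2)
    (Λ : ℕ → R → Ω → ℝ) (X : ℕ → Ω → Finset R)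
    (μ₀ v₀ : R → ℝ) (c₀ : ℕ → ℝ) (γ : ℤ → R → R → ℝ)
    (θ₀ τ₀ : EuclideanSpace ℝ (Fin p)) (η₀ : EuclideanSpace ℝ (Fin q))
    -- given the latent processes, the data are independent Poisson processes
    (hA1 : IsCoxSequence μ (regionVolume R) X Λ)
    -- the latent processes are log-Gaussian, with stationary zero-mean Gaussian part
    (hA2 : ∀ t, 1 ≤ t → ∀ u ω, Λ t u ω = Real.exp (μ₀ u + c₀ t + Y t u ω))
    (hA2_gauss : IsGaussianProcess (fun s : {t : ℕ // 1 ≤ t} × R ↦ Y s.1 s.2) μ)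
    (hA2_mean : ∀ t, 1 ≤ t → ∀ u, ∫ ω, Y t u ω ∂μ = 0)
    (hA2_cov : ∀ s t, 1 ≤ s → 1 ≤ t → ∀ u u',
      cov[Y s u, Y t u'; μ] = γ ((t : ℤ) - (s : ℤ)) u u')
    -- the mean function
    (hA3_mean : ∀ u, μ₀ u = inner ℝ θ₀ (β u))
    (hA3_trend : ∀ t, 1 ≤ t → c₀ t = inner ℝ η₀ (b (periodResidue r t)))
    -- the variance function
    (hv : ∀ t, 1 ≤ t → ∀ u, v₀ u = Var[Y t u; μ])
    (hA4 : ∀ u, v₀ u = inner ℝ τ₀ (β u))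
    -- the autocovariances vanish at infinity in the sup norm
    (hA5 : Tendsto (fun k : ℕ ↦ ⨆ (u : R) (u' : R), ‖γ (k : ℤ) u u'‖ₑ) atTop (𝓝 0))
    -- the estimators: a maximizer of the working log-likelihood whenever there is one
    (θhat : ℕ → Ω → EuclideanSpace ℝ (Fin p)) (ηhat : ℕ → Ω → EuclideanSpace ℝ (Fin q))
    (hest : ∀ n, 1 ≤ n → ∀ᵐ ω ∂μ,
      (∃ θ η, IsWorkingMLE (regionVolume R) r β b n (fun t ↦ X t ω) θ η) →
        IsWorkingMLE (regionVolume R) r β b n (fun t ↦ X t ω) (θhat n ω) (ηhat n ω)) :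
    TendstoInMeasure μ ηhat atTop (fun _ ↦ η₀) ∧
    TendstoInMeasure μ θhat atTop (fun _ ↦ θ₀ + (1 / 2 : ℝ) • τ₀) ∧
    (∀ t ∈ Set.Icc (1 : ℝ) (r : ℝ),
      TendstoInMeasure μ (fun n ω ↦ (inner ℝ (ηhat n ω) (b t) : ℝ)) atTop
        (fun _ ↦ (inner ℝ η₀ (b t) : ℝ))) ∧
    (∀ u : R,
      TendstoInMeasure μ (fun n ω ↦ Real.exp (inner ℝ (θhat n ω) (β u))) atTop
        (fun _ ↦ Real.exp (μ₀ u + v₀ u / 2))) := by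
  obtain ⟨C, hβC⟩ := hβb
  have hr : 0 < r := by omega
  have hν : regionVolume R ≠ 0 := fun h0 ↦ hR0 (by rw [← regionVolume_univ hR, h0]; simp)
  have : IsFiniteMeasure (regionVolume R) :=
    ⟨by rw [regionVolume_univ hR]; exact hRb.measure_lt_top⟩
  have hin := fun θ u ↦ abs_inner_le_of_bound hβC θ u
  have hin' := fun θ u ↦ (le_abs_self _).trans (hin θ u)
  have hvC : ∀ u, v₀ u ≤ ‖τ₀‖ * C := fun u ↦ (hA4 u).trans_le (hin' τ₀ u)
  obtain ⟨g, hg0, hg, hγg⟩ := tendsto_toReal_iSup_enorm (V := ‖τ₀‖ * C) (fun k u u' ↦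
    (abs_autocovariance_le hA2_gauss hA2_cov hv k u u').trans
      (by linarith [hvC u, hvC u'])) hA5
  have hμ' : μ₀ = fun u ↦ inner ℝ θ₀ (β u) := funext hA3_mean
  have hv' : v₀ = fun u ↦ inner ℝ τ₀ (β u) := funext hA4
  -- This places the mean intensity in the working model: the half variance of the log-normal mean
  -- shifts `θ₀` by half of `τ₀`.
  have hlam : ∀ u, μ₀ u + v₀ u / 2 = inner ℝ (θ₀ + (1 / 2 : ℝ) • τ₀) (β u) := fun u ↦ by
    rw [hA3_mean, hA4, inner_add_left, inner_smul_left, conj_trivial]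
    ring
  have hmom := hasIntensityMoments_logGaussian hYm hA2 hA2_gauss hA2_mean hA2_cov hv
    (by rw [hμ']; fun_prop) (by rw [hv']; fun_prop)
    (fun u ↦ (hA3_mean u).trans_le (hin' θ₀ u))
    (Cc := ∑ j ∈ Finset.Icc 1 r, |inner ℝ η₀ (b (j : ℝ))|)
    (fun t ht ↦ (hA3_trend t ht).trans_le ((le_abs_self _).trans
      (Finset.single_le_sum (f := fun j : ℕ ↦ |inner ℝ η₀ (b (j : ℝ))|)
        (fun _ _ ↦ abs_nonneg _) (periodResidue_mem hr t)))) hvC hγg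
  simp only [hlam] at hmom ⊢
  have havg := fun (a : ℕ → ℝ) (f : R → ℝ) (hf : Measurable f) (K : ℝ) (hK : ∀ u, |f u| ≤ K) ↦
    hmom.tendsto_average_sum hA1 hg0 hg hr (c' := fun j : ℕ ↦ inner ℝ η₀ (b j)) hA3_trend a hf hK
  have hlim : Tendsto (fun z : ℕ × Ω ↦ dataAverages r β b z.1 fun t ↦ X t z.2) (inProb μ)
      (𝓝 (limitAverages (regionVolume R) r β b (θ₀ + (1 / 2 : ℝ) • τ₀) η₀)) := by
    refine Tendsto.prodMk_nhds (tendsto_pi_nhds.2 fun j ↦ ?_) (Tendsto.prodMk_nhds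
      (tendsto_pi_nhds.2 fun l ↦ ?_) (tendsto_pi_nhds.2 fun l ↦ ?_))
    · exact (tendsto_average_periodResidue hr fun i ↦ if i = j then 1 else 0).comp
        tendsto_fst_inProb
    -- The factors `1` in `dataAverages` and `limitAverages` make this average and the next
    -- instances of the same law.
    · exact havg (fun j ↦ b j l) (fun _ ↦ 1) measurable_const 1 (by simp)
    · exact havg (fun _ ↦ 1) (fun u ↦ β u l) (by fun_prop) C fun u ↦
        (PiLp.norm_apply_le (β u) l).trans (hβC u)
  have hmax := tendsto_maximizer hν hr hβm hβC hβi hb hlim hest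
  have hθ := (continuous_fst.tendsto _).comp hmax
  have hη := (continuous_snd.tendsto _).comp hmax
  refine ⟨tendstoInMeasure_const_iff.2 hη, tendstoInMeasure_const_iff.2 hθ, fun t _ ↦ ?_,
    fun u ↦ ?_⟩
  · exact tendstoInMeasure_const_iff.2 (hη.inner tendsto_const_nhds)
  · exact tendstoInMeasure_const_iff.2
      ((Real.continuous_exp.tendsto _).comp (hθ.inner tendsto_const_nhds))
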